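/- Let $\mathbf{T}^2=\mathbf{R}^2/\mathbf{Z}^2$ with its flat (Euclidean) metric $d$, and let $\mathcal H$ be either the set $\mathrm{Homeo}_0(\mathbf{T}^2)$ of homeomorphisms of $\mathbf{T}^2$ isotopic to the identity, or its subset $\mathrm{Homeo}_{0,\lambda}(\mathbf{T}^2)$ of those that preserve Lebesgue measure. Put $d_{C^0}(f,g)=\sup_{x} d(f(x),g(x))$. For a lift $\tilde f\colon\mathbf{R}^2\to\mathbf{R}^2$ of $f\in\mathcal H$, define: - the rotation set $\rho(\tilde f)$, the set of all limits $\lim_k (\tilde f^{n_k}(z_k)-z_k)/n_k$ with $z_k\in\mathbf{R}^2$ and integers $n_k\to\infty$; - an $\eta$-pseudo-orbit of $\tilde f$, a (finite or infinite) sequence $(\tilde x_i)$ in $\mathbf{R}^2$ with $\|\tilde f(\tilde x_i)-\tilde x_{i+1}\|<\eta$ for all $i$ for which both terms are defined; - the $\eta$-pseudo-rotation set $\rho_\eta(\tilde f)$, the set of all limits $\lim_k (x^k_{n_k}-x^k_0)/n_k$ with $n_k\to\infty$ and $(x^k_i)_{0\le i\le n_k}$ an $\eta$-pseudo-orbit of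 $\tilde f$ for each $k$; - the oscillation $\operatorname{osc}(f)=\sup_{x,y\in\mathbf{R}^2}\|(\tilde f(x)-x)-(\tilde f(y)-y)\|$, which does not depend on the lift. The rotation sets of two lifts of $f$ differ by an integer translation, and $\rho(f)$ denotes $\rho(\tilde f)$ modulo integer translations; thus $\rho(g)\subset\rho(f)$ means that for any lift $\tilde f$ of $f$ there is a lift $\tilde g$ of $g$ with $\rho(\tilde g)\subset\rho(\tilde f)$. For $\epsilon>0$, the set $\rho(f)$ is called $\epsilon$-upper-stable if $\rho(g)\subset\rho(f)$ for every $g\in\mathcal H$ with $d_{C^0}(f,g)<\epsilon$. **Theorem.** Let $f\in\mathcal H$, let $0<\epsilon<1$, and suppose that $\rho(f)$ is $\epsilon$-upper-stable. Then for every lift $\tilde f$ of $f$: 1. $\rho_{\epsilon/2}(\tilde f)=\rho(\tilde f)$. 2. For every $\epsilon/2$-pseudo-orbit $(\tilde x_i)_{i\in\mathbf{N}}$ of $\tilde f$ and every $n\in\mathbf{N}$, $$d\big(\tilde x_n-\tilde x_0,\ n\rho(\tilde f)\big)\le \frac{16}{\pi\epsilon^2}\big(\operatorname{osc}(f)+2\big)+\epsilon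 .$$ 3. For every orbit $(\tilde x_i)_{i\in\mathbf{N}}$ of $\tilde f$ (that is, $\tilde x_{i+1}=\tilde f(\tilde x_i)$) and every $n\in\mathbf{N}$, $$d\big(\tilde x_n-\tilde x_0,\ n\rho(\tilde f)\big)\le \frac{4\big(\operatorname{osc}(f)+1\big)}{\pi\epsilon^2}+\epsilon .$$ In 2 and 3, $d(\cdot,\cdot)$ is the Euclidean distance from a point to a set. -/

import Mathlib

open Filter Topology MeasureTheory
open scoped Pointwise

noncomputable section

namespace TorusRotation

/-- The plane `ℝ²` with its Euclidean norm. -/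
abbrev Plane : Type := EuclideanSpace ℝ (Fin 2)

/-- The torus `𝕋² = ℝ²/ℤ²`, with the product topology and with `volume` the Lebesgue (Haar)
probability measure. -/
abbrev Torus : Type := Fin 2 → UnitAddCircle

/-- The covering projection `ℝ² → 𝕋²`. -/
def proj (x : Plane) : Torus := fun i => (x i : UnitAddCircle)

/-- The flat (Euclidean) distance on the torus; `‖a‖` on `ℝ/ℤ` is the distance of a
representative to the nearest integer. -/
def torusDist (x y : Torus) : ℝ := Real.sqrt (∑ i, ‖x i - y i‖ ^ 2)

/-- The uniform distance `sup_x d(f x, g x)`. -/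
def distC0 (f g : Torus ≃ₜ Torus) : ℝ := ⨆ x, torusDist (f x) (g x)

/-- `f` is isotopic to the identity. -/
def IsotopicToId (f : Torus ≃ₜ Torus) : Prop :=
  ∃ h : unitInterval → (Torus ≃ₜ Torus),
    Continuous (fun p : unitInterval × Torus => h p.1 p.2) ∧
      h 0 = Homeomorph.refl Torus ∧ h 1 = f

/-- The homeomorphisms of the torus isotopic to the identity. -/
def Homeo0 : Set (Torus ≃ₜ Torus) := {f | IsotopicToId f}

/-- The area-preserving homeomorphisms of the torus isotopic to the identity. -/
def Homeo0Area : Set (Torus ≃ₜ Torus) :=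
  {f | IsotopicToId f ∧ MeasurePreserving f volume volume}

/-- `F` is a lift of `f` to the plane. -/
def IsLift (F : Plane → Plane) (f : Torus ≃ₜ Torus) : Prop :=
  Continuous F ∧ ∀ x, proj (F x) = f (proj x)

/-- The rotation set of a lift: all limits of `(F^{n_k}(z_k) - z_k) / n_k` with `n_k → ∞`. -/
def rotationSet (F : Plane → Plane) : Set Plane :=
  {v | ∃ (n : ℕ → ℕ) (z : ℕ → Plane), Tendsto n atTop atTop ∧
    Tendsto (fun k => (n k : ℝ)⁻¹ • (F^[n k] (z k) - z k)) atTop (𝓝 v)}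

/-- The `ε`-pseudo-rotation set of a lift: all limits of `(x^k_{n_k} - x^k_0) / n_k` with
`n_k → ∞` and `(x^k_i)_{0 ≤ i ≤ n_k}` an `ε`-pseudo-orbit of `F`. -/
def pseudoRotationSet (ε : ℝ) (F : Plane → Plane) : Set Plane :=
  {v | ∃ (n : ℕ → ℕ) (x : ℕ → ℕ → Plane), Tendsto n atTop atTop ∧
    (∀ k, ∀ i < n k, dist (F (x k i)) (x k (i + 1)) < ε) ∧
    Tendsto (fun k => (n k : ℝ)⁻¹ • (x k (n k) - x k 0)) atTop (𝓝 v)}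

/-- Infinite `ε`-pseudo-orbits of `F`. -/
def IsPseudoOrbit (ε : ℝ) (F : Plane → Plane) (x : ℕ → Plane) : Prop :=
  ∀ i, dist (F (x i)) (x (i + 1)) < ε

/-- Orbits of `F`. -/
def IsOrbit (F : Plane → Plane) (x : ℕ → Plane) : Prop :=
  ∀ i, x (i + 1) = F (x i)

/-- The oscillation of a lift; two lifts of the same homeomorphism isotopic to the identity differ
by a constant vector and so have the same oscillation. -/
def osc (F : Plane → Plane) : ℝ :=
  ⨆ p : Plane × Plane, ‖(F p.1 - p.1) - (F p.2 - p.2)‖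

/-- `ρ(g) ⊂ ρ(f)`. The rotation set of a homeomorphism is a class of compact subsets of the plane
modulo integer translations, a representative for each lift; the inclusion is one between
representatives. -/
def RotationSubset (g f : Torus ≃ₜ Torus) : Prop :=
  ∀ F, IsLift F f → ∃ G, IsLift G g ∧ rotationSet G ⊆ rotationSet F

/-- The rotation set of `f` is `δ`-upper-stable with respect to perturbations in `H`. -/
def IsUpperStable (H : Set (Torus ≃ₜ Torus)) (δ : ℝ) (f : Torus ≃ₜ Torus) : Prop :=
  0 < δ ∧ ∀ g ∈ H, distC0 f g < δ → RotationSubset g f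

end TorusRotation

end

namespace TorusRotation

/-! ### The integer lattice and the covering projection -/

/-- The lattice `ℤ²` in the plane. -/
def intLattice : AddSubgroup Plane where
  carrier := {v | ∀ i, ∃ m : ℤ, v i = m}
  zero_mem' := fun _ => ⟨0, by simp⟩
  add_mem' := by
    intro a b ha hb i
    obtain ⟨m, hm⟩ := ha i
    obtain ⟨k, hk⟩ := hb i
    exact ⟨m + k, by simp [hm, hk]⟩
  neg_mem' := by
    intro a ha i
    obtain ⟨m, hm⟩ := ha i
    exact ⟨-m, by simp [hm]⟩

theorem mem_intLattice {v : Plane} : v ∈ intLattice ↔ ∀ i, ∃ m : ℤ, v i = m := Iff.rfl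

theorem coe_eq_coe_iff {a b : ℝ} :
    (a : UnitAddCircle) = (b : UnitAddCircle) ↔ ∃ m : ℤ, a - b = m := by
  rw [← sub_eq_zero, ← AddCircle.coe_sub, AddCircle.coe_eq_zero_iff]
  simp [eq_comm]

theorem proj_eq_proj_iff {x y : Plane} : proj x = proj y ↔ x - y ∈ intLattice := by
  simp only [proj, funext_iff, coe_eq_coe_iff, mem_intLattice, PiLp.sub_apply]

theorem proj_add (x y : Plane) : proj (x + y) = proj x + proj y := by
  ext i; simp [proj]

theorem proj_sub (x y : Plane) : proj (x - y) = proj x - proj y := by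
  ext i; simp [proj]

theorem continuous_proj : Continuous proj := by
  refine continuous_pi fun i => ?_
  exact (AddCircle.continuous_mk' 1).comp (by fun_prop : Continuous fun x : Plane => x i)

theorem proj_surjective : Function.Surjective proj := by
  intro y
  choose x hx using fun i => QuotientAddGroup.mk_surjective (y i)
  exact ⟨WithLp.toLp 2 x, funext hx⟩

theorem isOpenQuotientMap_proj : IsOpenQuotientMap proj := by
  refine ⟨proj_surjective, continuous_proj, ?_⟩
  have h : IsOpenMap (Pi.map fun (_ : Fin 2) (a : ℝ) => (a : UnitAddCircle)) :=
    IsOpenMap.piMap (fun _ => QuotientAddGroup.isOpenMap_coe)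
      (by simp [QuotientAddGroup.mk_surjective])
  exact h.comp (PiLp.homeomorph 2 fun _ : Fin 2 => ℝ).isOpenMap

theorem abs_apply_le_norm (x : Plane) (i : Fin 2) : |x i| ≤ ‖x‖ := by
  simpa using PiLp.norm_apply_le x i

theorem one_le_norm_of_mem_intLattice {v : Plane} (hv : v ∈ intLattice) (h0 : v ≠ 0) :
    1 ≤ ‖v‖ := by
  have : ∃ i, v i ≠ 0 := by
    by_contra! h
    exact h0 (by ext i; simpa using h i)
  obtain ⟨i, hi⟩ := this
  obtain ⟨m, hm⟩ := hv i
  refine le_trans ?_ (abs_apply_le_norm v i)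
  rw [hm] at hi ⊢
  have : m ≠ 0 := by rintro rfl; simp at hi
  rw [← Int.cast_abs]
  exact_mod_cast Int.one_le_abs this

theorem eq_zero_of_mem_intLattice {v : Plane} (hv : v ∈ intLattice) (h : ‖v‖ < 1) : v = 0 := by
  by_contra h0
  exact absurd (one_le_norm_of_mem_intLattice hv h0) (not_le.2 h)

/-- The nearest integer vector, coordinatewise. -/
noncomputable def roundVec (x : Plane) : Plane := WithLp.toLp 2 fun i => ((round (x i) : ℤ) : ℝ)

theorem roundVec_apply (x : Plane) (i : Fin 2) : roundVec x i = round (x i) := rfl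

theorem roundVec_mem (x : Plane) : roundVec x ∈ intLattice := fun i => ⟨round (x i), rfl⟩

theorem norm_coe_le_abs (a : ℝ) : ‖(a : UnitAddCircle)‖ ≤ |a| := by
  rw [UnitAddCircle.norm_eq]
  simpa using round_le a 0

theorem torusDist_proj_le (x y : Plane) : torusDist (proj x) (proj y) ≤ ‖x - y‖ := by
  rw [torusDist, EuclideanSpace.norm_eq]
  refine Real.sqrt_le_sqrt (Finset.sum_le_sum fun i _ => ?_)
  have : proj x i - proj y i = ((x i - y i : ℝ) : UnitAddCircle) := by simp [proj]
  rw [this]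
  refine pow_le_pow_left₀ (norm_nonneg _) ?_ 2
  simpa using norm_coe_le_abs (x i - y i)

theorem countable_intLattice : (intLattice : Set Plane).Countable := by
  have : (intLattice : Set Plane) ⊆
      Set.range fun m : Fin 2 → ℤ => (WithLp.toLp 2 fun i => (m i : ℝ) : Plane) := by
    intro v hv
    choose m hm using hv
    exact ⟨m, by ext i; simp [hm]⟩
  exact (Set.countable_range _).mono this

/-- A continuous lattice-valued map on a preconnected space is constant. -/
theorem eq_of_continuous_of_mem_intLattice {A : Type*} [TopologicalSpace A] [PreconnectedSpace A]
    {u : A → Plane} (hu : Continuous u) (h : ∀ a, u a ∈ intLattice) (a b : A) : u a = u b := by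
  ext i
  choose m hm using fun a => h a i
  have hc : Continuous fun a => (m a : ℝ) := by
    simp_rw [← hm]; fun_prop
  have hmc : Continuous m := Int.isClosedEmbedding_coe_real.isEmbedding.continuous_iff.2 hc
  rw [hm, hm, PreconnectedSpace.constant ‹_› hmc]

/-! ### Lifts of homeomorphisms isotopic to the identity -/

variable {f g : Torus ≃ₜ Torus} {F G : Plane → Plane}

theorem IsotopicToId.exists_displacement (hf : IsotopicToId f) :
    ∃ u : Torus → Plane, Continuous u ∧ ∀ y, f y = y + proj (u y) := by
  obtain ⟨h, hc, h0, h1⟩ := hf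
  have key : ∀ i : Fin 2, ∃ v : Torus → ℝ, Continuous v ∧
      ∀ y, (f y i) = y i + (v y : UnitAddCircle) := by
    intro i
    let H : C(unitInterval × Torus, UnitAddCircle) :=
      ⟨fun p => h p.1 p.2 i - p.2 i, by fun_prop⟩
    have H0 : ∀ y, H (0, y) = ((ContinuousMap.const Torus (0 : ℝ)) y : UnitAddCircle) := by
      intro y; simp [H, h0]
    let L := (AddCircle.isCoveringMap_coe (1 : ℝ)).liftHomotopy H _ H0
    have hL := (AddCircle.isCoveringMap_coe (1 : ℝ)).liftHomotopy_lifts H _ H0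
    refine ⟨fun y => L (1, y), by fun_prop, fun y => ?_⟩
    have := congrFun hL (1, y)
    simp only [Function.comp_apply] at this
    change (L (1, y) : UnitAddCircle) = h 1 y i - y i at this
    rw [this, h1]; simp
  choose v hvc hv using key
  exact ⟨fun y => WithLp.toLp 2 fun i => v i y, by fun_prop, fun y => by
    ext i; simp [hv, proj]⟩

theorem IsLift.exists_displacement (hf : IsotopicToId f) (hF : IsLift F f) :
    ∃ u : Torus → Plane, Continuous u ∧ ∀ x, F x = x + u (proj x) := by
  obtain ⟨u, hu, hfu⟩ := hf.exists_displacement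
  have hc : Continuous fun x => F x - (x + u (proj x)) :=
    hF.1.sub (continuous_id.add (hu.comp continuous_proj))
  have hm : ∀ x, F x - (x + u (proj x)) ∈ intLattice := by
    intro x
    rw [← proj_eq_proj_iff, hF.2, hfu, proj_add]
  refine ⟨fun y => u y + (F 0 - (0 + u (proj 0))), by fun_prop, fun x => ?_⟩
  have := eq_of_continuous_of_mem_intLattice hc hm x 0
  simp only [← this]; module

theorem IsLift.map_add (hf : IsotopicToId f) (hF : IsLift F f) (x : Plane) {v : Plane}
    (hv : v ∈ intLattice) : F (x + v) = F x + v := by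
  obtain ⟨u, -, hu⟩ := hF.exists_displacement hf
  have : proj (x + v) = proj x := proj_eq_proj_iff.2 (by simpa using hv)
  rw [hu, hu, this]; abel

theorem IsLift.injective (hf : IsotopicToId f) (hF : IsLift F f) : Function.Injective F := by
  intro x y hxy
  have h : proj x = proj y := f.injective (by rw [← hF.2, ← hF.2, hxy])
  have hv := proj_eq_proj_iff.1 h
  have := hF.map_add hf y hv
  rw [add_sub_cancel, hxy] at this
  exact sub_eq_zero.1 (left_eq_add.1 this)

theorem IsLift.exists_bound (hf : IsotopicToId f) (hF : IsLift F f) :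
    ∃ C, 0 ≤ C ∧ ∀ x, ‖F x - x‖ ≤ C := by
  obtain ⟨u, hu, hFu⟩ := hF.exists_displacement hf
  obtain ⟨C, hC⟩ := isCompact_univ.exists_bound_of_continuousOn (f := u) hu.continuousOn
  exact ⟨C, (norm_nonneg _).trans (hC 0 trivial), fun x => by
    rw [hFu x, add_sub_cancel_left]; exact hC _ trivial⟩

theorem IsLift.exists_eq_add (hF : IsLift F f) (hG : IsLift G f) :
    ∃ k ∈ intLattice, ∀ x, G x = F x + k := by
  have hm : ∀ x, G x - F x ∈ intLattice := by
    intro x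
    rw [← proj_eq_proj_iff, hF.2, hG.2]
  refine ⟨G 0 - F 0, hm 0, fun x => ?_⟩
  have := eq_of_continuous_of_mem_intLattice (hG.1.sub hF.1) hm x 0
  simp only [Pi.sub_apply] at this
  rw [← this]; simp

theorem IsLift.comp (hG : IsLift G g) (hF : IsLift F f) : IsLift (G ∘ F) (f.trans g) :=
  ⟨hG.1.comp hF.1, fun x => by simp [hG.2, hF.2]⟩

theorem IsotopicToId.trans (hf : IsotopicToId f) (hg : IsotopicToId g) :
    IsotopicToId (f.trans g) := by
  obtain ⟨h, hc, h0, h1⟩ := hf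
  obtain ⟨k, kc, k0, k1⟩ := hg
  refine ⟨fun t => (h t).trans (k t), ?_, ?_, ?_⟩
  · exact kc.comp (continuous_fst.prodMk hc)
  · simp only [h0, k0]; rfl
  · simp only [h1, k1]

theorem Homeo0Area.trans (hf : f ∈ Homeo0Area) (hg : g ∈ Homeo0Area) :
    f.trans g ∈ Homeo0Area :=
  ⟨hf.1.trans hg.1, hg.2.comp hf.2⟩

theorem refl_mem_Homeo0Area : Homeomorph.refl Torus ∈ Homeo0Area :=
  ⟨⟨fun _ => Homeomorph.refl Torus, continuous_snd, rfl, rfl⟩, MeasurePreserving.id _⟩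

theorem isLift_id : IsLift id (Homeomorph.refl Torus) := ⟨continuous_id, fun _ => rfl⟩

/-! ### Rotation sets of maps that commute with integer translations -/

/-- Continuous injective maps of the plane that commute with integer translations and have bounded
displacement. -/
structure IsEquivariant (F : Plane → Plane) : Prop where
  continuous : Continuous F
  injective : Function.Injective F
  map_add_lattice : ∀ x, ∀ v ∈ intLattice, F (x + v) = F x + v
  bounded : ∃ C, 0 ≤ C ∧ ∀ x, ‖F x - x‖ ≤ C

theorem IsLift.isEquivariant {f : Torus ≃ₜ Torus} {F : Plane → Plane} (hf : IsotopicToId f)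
    (hF : IsLift F f) : IsEquivariant F :=
  ⟨hF.1, hF.injective hf, fun x _ hv => hF.map_add hf x hv, hF.exists_bound hf⟩

namespace IsEquivariant

theorem norm_iterate_sub_le {C : ℝ} (hC : ∀ x, ‖F x - x‖ ≤ C) (n : ℕ) (x : Plane) :
    ‖F^[n] x - x‖ ≤ n * C := by
  induction n with
  | zero => simp
  | succ n ih =>
    rw [Function.iterate_succ_apply']
    calc ‖F (F^[n] x) - x‖ = ‖(F (F^[n] x) - F^[n] x) + (F^[n] x - x)‖ := by congr 1; abel
      _ ≤ C + n * C := (norm_add_le _ _).trans (add_le_add (hC _) ih)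
      _ = _ := by push_cast; ring

theorem iterate (hF : IsEquivariant F) (n : ℕ) : IsEquivariant F^[n] := by
  obtain ⟨C, hC0, hC⟩ := hF.bounded
  refine ⟨hF.continuous.iterate n, hF.injective.iterate n, fun x v hv => ?_,
    ⟨n * C, by positivity, norm_iterate_sub_le hC n⟩⟩
  induction n with
  | zero => rfl
  | succ n ih => rw [Function.iterate_succ_apply', ih, hF.map_add_lattice _ _ hv,
      Function.iterate_succ_apply']

theorem iterate_add_const (hF : IsEquivariant F) {k : Plane} (hk : k ∈ intLattice) (n : ℕ)
    (x : Plane) : (fun x => F x + k)^[n] x = F^[n] x + (n : ℝ) • k := by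
  induction n with
  | zero => simp
  | succ n ih =>
    have hnk : (n : ℝ) • k ∈ intLattice := by
      rw [Nat.cast_smul_eq_nsmul]; exact nsmul_mem hk n
    rw [Function.iterate_succ_apply', ih]
    simp only [hF.map_add_lattice _ _ hnk, Function.iterate_succ_apply']
    push_cast
    module

theorem iterate_mul (hF : IsEquivariant F) {q : ℕ} {x v : Plane} (hv : v ∈ intLattice)
    (h : F^[q] x = x + v) (n : ℕ) : F^[q * n] x = x + (n : ℝ) • v := by
  induction n with
  | zero => simp
  | succ n ih =>
    have hnk : (n : ℝ) • v ∈ intLattice := by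
      rw [Nat.cast_smul_eq_nsmul]; exact nsmul_mem hv n
    rw [Nat.mul_succ, Nat.add_comm, Function.iterate_add_apply, ih,
      (hF.iterate q).map_add_lattice _ _ hnk,
      h]
    push_cast
    module

/-- Periodic points of the quotient map have rotation vectors in the rotation set. -/
theorem inv_smul_mem_rotationSet (hF : IsEquivariant F) {q : ℕ} (hq : 0 < q) {x v : Plane}
    (hv : v ∈ intLattice) (h : F^[q] x = x + v) : (q : ℝ)⁻¹ • v ∈ rotationSet F := by
  refine ⟨fun k => q * (k + 1), fun _ => x, ?_, ?_⟩
  · exact (tendsto_add_atTop_nat 1).const_mul_atTop' hq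
  · refine tendsto_const_nhds.congr fun k => ?_
    rw [hF.iterate_mul hv h, add_sub_cancel_left, smul_smul]
    congr 1
    push_cast
    have : (k : ℝ) + 1 ≠ 0 := by positivity
    field_simp

theorem add_mem_rotationSet_add_const (hF : IsEquivariant F) {k : Plane} (hk : k ∈ intLattice)
    {w : Plane} (hw : w ∈ rotationSet F) : w + k ∈ rotationSet fun x => F x + k := by
  obtain ⟨n, z, hn, hz⟩ := hw
  refine ⟨n, z, hn, (hz.add_const k).congr' ?_⟩
  filter_upwards [hn.eventually_gt_atTop 0] with j hj
  rw [hF.iterate_add_const hk]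
  have : (n j : ℝ) ≠ 0 := by positivity
  rw [add_sub_right_comm, smul_add, smul_smul, inv_mul_cancel₀ this, one_smul]

theorem norm_inv_smul_le {C : ℝ} (hC0 : 0 ≤ C) (hC : ∀ x, ‖F x - x‖ ≤ C) (n : ℕ) (x : Plane) :
    ‖(n : ℝ)⁻¹ • (F^[n] x - x)‖ ≤ C := by
  rcases n.eq_zero_or_pos with rfl | hn
  · simpa using hC0
  · have hn' : (0 : ℝ) < n := by exact_mod_cast hn
    rw [norm_smul, norm_inv, Real.norm_natCast, inv_mul_le_iff₀ hn']
    exact norm_iterate_sub_le hC n x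

theorem exists_subseq_mem_rotationSet (hF : IsEquivariant F) {n : ℕ → ℕ}
    (hn : Tendsto n atTop atTop) (z : ℕ → Plane) :
    ∃ w ∈ rotationSet F, ∃ φ : ℕ → ℕ, StrictMono φ ∧
      Tendsto (fun k => (n (φ k) : ℝ)⁻¹ • (F^[n (φ k)] (z (φ k)) - z (φ k))) atTop (𝓝 w) := by
  obtain ⟨C, hC0, hC⟩ := hF.bounded
  obtain ⟨w, -, φ, hφ, hw⟩ := (isCompact_closedBall (0 : Plane) C).tendsto_subseq
    (x := fun k => (n k : ℝ)⁻¹ • (F^[n k] (z k) - z k))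
    (fun k => by simpa using norm_inv_smul_le hC0 hC (n k) (z k))
  exact ⟨w, ⟨fun k => n (φ k), fun k => z (φ k), hn.comp hφ.tendsto_atTop, hw⟩, φ, hφ, hw⟩

theorem rotationSet_nonempty (hF : IsEquivariant F) : (rotationSet F).Nonempty := by
  obtain ⟨w, hw, -⟩ := hF.exists_subseq_mem_rotationSet tendsto_id (fun _ => 0)
  exact ⟨w, hw⟩

end IsEquivariant

theorem mem_rotationSet_iff {w : Plane} : w ∈ rotationSet F ↔
    ∀ δ > 0, ∀ N : ℕ, ∃ n ≥ N, ∃ z, ‖(n : ℝ)⁻¹ • (F^[n] z - z) - w‖ < δ := by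
  constructor
  · rintro ⟨n, z, hn, hz⟩ δ hδ N
    obtain ⟨k, hk1, hk2⟩ := ((hn.eventually_ge_atTop N).and
      (Metric.tendsto_nhds.1 hz δ hδ)).exists
    exact ⟨n k, hk1, z k, by simpa [dist_eq_norm] using hk2⟩
  · intro h
    choose n hn z hz using fun k : ℕ => h (1 / ((k : ℝ) + 1)) (by positivity) k
    refine ⟨n, z, tendsto_atTop_mono hn tendsto_id, ?_⟩
    rw [tendsto_iff_norm_sub_tendsto_zero]
    exact squeeze_zero (fun _ => norm_nonneg _) (fun k => (hz k).le)
      tendsto_one_div_add_atTop_nhds_zero_nat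

theorem isClosed_rotationSet : IsClosed (rotationSet F) := by
  rw [← closure_subset_iff_isClosed]
  intro w hw
  rw [mem_rotationSet_iff]
  intro δ hδ N
  obtain ⟨w', hw', hd⟩ := Metric.mem_closure_iff.1 hw (δ / 2) (by positivity)
  obtain ⟨n, hn, z, hz⟩ := mem_rotationSet_iff.1 hw' (δ / 2) (by positivity) N
  refine ⟨n, hn, z, ?_⟩
  rw [← dist_eq_norm] at hz ⊢
  linarith [dist_triangle ((n : ℝ)⁻¹ • (F^[n] z - z)) w' w, dist_comm w w']

namespace IsEquivariant

/-- A linear functional bounded on the displacements of `F^[n]` is bounded on `n • ρ(F)`. -/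
theorem apply_smul_le (hF : IsEquivariant F) (L : Plane →L[ℝ] ℝ) {n : ℕ} {c : ℝ}
    (hL : ∀ z, L (F^[n] z - z) ≤ c) {w : Plane} (hw : w ∈ rotationSet F) : n * L w ≤ c := by
  obtain ⟨C, hC0, hC⟩ := hF.bounded
  have hq : ∀ q z, L (F^[n * q] z - z) ≤ q * c := by
    intro q z
    induction q with
    | zero => simp
    | succ q ih =>
      have : F^[n * (q + 1)] z - z =
          (F^[n] (F^[n * q] z) - F^[n * q] z) + (F^[n * q] z - z) := by
        rw [Nat.mul_succ, Nat.add_comm, Function.iterate_add_apply]; abel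
      rw [this, map_add]
      push_cast
      linarith [hL (F^[n * q] z)]
  rcases n.eq_zero_or_pos with rfl | hn
  · simpa using hL 0
  obtain ⟨N, z, hN, hz⟩ := hw
  set K := n * (|c| + ‖L‖ * (n * C)) with hK
  have hb : ∀ N z, n * L (F^[N] z - z) ≤ N * c + K := by
    intro N z
    have h1 : F^[N] z - z = (F^[N % n] (F^[n * (N / n)] z) - F^[n * (N / n)] z) +
        (F^[n * (N / n)] z - z) := by
      rw [← Function.iterate_add_apply, Nat.mod_add_div]; abel
    have h2 : L (F^[N % n] (F^[n * (N / n)] z) - F^[n * (N / n)] z) ≤ ‖L‖ * (n * C) := by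
      refine (le_abs_self _).trans ((L.le_opNorm _).trans ?_)
      gcongr
      refine (norm_iterate_sub_le hC _ _).trans ?_
      gcongr
      exact (Nat.mod_lt _ hn).le
    have h3 := hq (N / n) z
    have h4 : (N : ℝ) = (N % n : ℕ) + n * (N / n : ℕ) := by
      exact_mod_cast (Nat.mod_add_div N n).symm
    have h5 : ((N % n : ℕ) : ℝ) ≤ n := by exact_mod_cast (Nat.mod_lt _ hn).le
    have h6 : -(n * |c|) ≤ (N % n : ℕ) * c := by
      have := neg_abs_le c
      have h7 : ((N % n : ℕ) : ℝ) * |c| ≤ n * |c| := by gcongr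
      have h8 : ((N % n : ℕ) : ℝ) * (-|c|) ≤ (N % n : ℕ) * c := by gcongr
      linarith
    rw [h1, map_add]
    calc n * (L (F^[N % n] (F^[n * (N / n)] z) - F^[n * (N / n)] z) + L (F^[n * (N / n)] z - z))
        ≤ n * (‖L‖ * (n * C) + (N / n : ℕ) * c) := by gcongr
      _ ≤ N * c + K := by rw [h4, hK]; linarith
  have hl : Tendsto (fun k => n * L ((N k : ℝ)⁻¹ • (F^[N k] (z k) - z k))) atTop (𝓝 (n * L w)) :=
    ((L.continuous.tendsto w).comp hz).const_mul _
  have hr : Tendsto (fun k => c + K * (N k : ℝ)⁻¹) atTop (𝓝 (c + K * 0)) :=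
    ((tendsto_inv_atTop_zero.comp (tendsto_natCast_atTop_atTop.comp hN)).const_mul K).const_add c
  rw [mul_zero, add_zero] at hr
  refine le_of_tendsto_of_tendsto hl hr ?_
  filter_upwards [hN.eventually_gt_atTop 0] with k hk
  have hk' : (0 : ℝ) < N k := by exact_mod_cast hk
  have := hb (N k) (z k)
  rw [map_smul, smul_eq_mul, ← mul_assoc, mul_comm (n : ℝ), mul_assoc, inv_mul_le_iff₀ hk']
  field_simp
  linarith

theorem norm_le_of_mem_rotationSet {C : ℝ} (hC0 : 0 ≤ C) (hC : ∀ x, ‖F x - x‖ ≤ C) {w : Plane}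
    (hw : w ∈ rotationSet F) : ‖w‖ ≤ C := by
  obtain ⟨n, z, -, hz⟩ := hw
  exact le_of_tendsto hz.norm (Eventually.of_forall fun k => norm_inv_smul_le hC0 hC _ _)

theorem bddAbove_osc (hF : IsEquivariant F) :
    BddAbove (Set.range fun p : Plane × Plane => ‖(F p.1 - p.1) - (F p.2 - p.2)‖) := by
  obtain ⟨C, hC0, hC⟩ := hF.bounded
  refine ⟨C + C, ?_⟩
  rintro _ ⟨p, rfl⟩
  exact (norm_sub_le _ _).trans (add_le_add (hC _) (hC _))

theorem norm_sub_le_osc (hF : IsEquivariant F) (x y : Plane) :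
    ‖(F x - x) - (F y - y)‖ ≤ osc F :=
  le_ciSup hF.bddAbove_osc (x, y)

theorem osc_nonneg (hF : IsEquivariant F) : 0 ≤ osc F :=
  (norm_nonneg _).trans (hF.norm_sub_le_osc 0 0)

/-- Every displacement is within the oscillation of every rotation vector. -/
theorem norm_displacement_sub_le_osc (hF : IsEquivariant F) (x : Plane) {w : Plane}
    (hw : w ∈ rotationSet F) : ‖F x - x - w‖ ≤ osc F := by
  have hb : ∀ (n : ℕ) z, ‖(n : ℝ) • (F x - x) - (F^[n] z - z)‖ ≤ n * osc F := by
    intro n z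
    induction n with
    | zero => simp
    | succ n ih =>
      have : ((n + 1 : ℕ) : ℝ) • (F x - x) - (F^[n + 1] z - z) =
          ((n : ℝ) • (F x - x) - (F^[n] z - z)) +
            ((F x - x) - (F (F^[n] z) - F^[n] z)) := by
        rw [Function.iterate_succ_apply']; push_cast; module
      rw [this]
      refine (norm_add_le _ _).trans ?_
      push_cast
      linarith [hF.norm_sub_le_osc x (F^[n] z)]
  obtain ⟨n, z, hn, hz⟩ := hw
  refine le_of_tendsto (hz.const_sub (F x - x)).norm ?_
  filter_upwards [hn.eventually_gt_atTop 0] with k hk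
  have hk' : (0 : ℝ) < n k := by exact_mod_cast hk
  have h1 : F x - x - (n k : ℝ)⁻¹ • (F^[n k] (z k) - z k) =
      (n k : ℝ)⁻¹ • ((n k : ℝ) • (F x - x) - (F^[n k] (z k) - z k)) := by
    rw [smul_sub _ ((n k : ℝ) • _), smul_smul, inv_mul_cancel₀ hk'.ne', one_smul]
  rw [h1, norm_smul, norm_inv, Real.norm_natCast, inv_mul_le_iff₀ hk']
  exact hb _ _

end IsEquivariant

/-! ### Crossing lemmas for plane paths -/

/-- A nowhere vanishing continuous function on a real topological vector space has a continuous
logarithm. -/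
theorem exists_continuous_exp_eq {E : Type*} [AddCommGroup E] [Module ℝ E] [TopologicalSpace E]
    [ContinuousSMul ℝ E] {f : E → ℂ} (hf : Continuous f) (h0 : ∀ x, f x ≠ 0) :
    ∃ g : E → ℂ, Continuous g ∧ ∀ x, Complex.exp (g x) = f x := by
  let H : C(unitInterval × E, {z : ℂ // z ≠ 0}) :=
    ⟨fun p => ⟨f ((p.1 : ℝ) • p.2), h0 _⟩, by fun_prop⟩
  have H0 : ∀ x, H (0, x) =
      ⟨Complex.exp (ContinuousMap.const E (Complex.log (f 0)) x), Complex.exp_ne_zero _⟩ := by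
    intro x
    simp [H, Complex.exp_log (h0 0)]
  refine ⟨fun x => Complex.isCoveringMap_exp.liftHomotopy H _ H0 (1, x), by fun_prop, fun x => ?_⟩
  have := congrFun (Complex.isCoveringMap_exp.liftHomotopy_lifts H _ H0) (1, x)
  simpa [H] using congrArg Subtype.val this

/-- Two continuous logarithms of the same function differ by a constant. -/
theorem sub_eq_sub_of_exp_eq {A : Type*} [TopologicalSpace A] [PreconnectedSpace A] {g h : A → ℂ}
    (hg : Continuous g) (hh : Continuous h) (he : ∀ a, Complex.exp (g a) = Complex.exp (h a))
    (a b : A) : g a - h a = g b - h b := by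
  choose m hm using fun a => Complex.exp_eq_exp_iff_exists_int.1 (he a)
  have hc : Continuous fun a => (m a : ℝ) := by
    have : (fun a => (m a : ℝ)) = fun a => (g a - h a).im / (2 * Real.pi) := by
      ext a
      rw [hm a]
      have := Real.pi_pos
      simp
    rw [this]; fun_prop
  have hmc : Continuous m := Int.isClosedEmbedding_coe_real.isEmbedding.continuous_iff.2 hc
  rw [hm a, hm b, PreconnectedSpace.constant ‹_› hmc (x := a) (y := b)]
  ring

/-- A path `X` that winds by more than a half turn around `0` and whose ends are below the path `τ`
meets `τ`, if `τ` starts at `0` and ends above `X`. -/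
theorem exists_mem_of_winding {X τ G : ℝ → ℂ} (hX : Continuous X) (hτ : Continuous τ)
    (hG : Continuous G) (hXG : ∀ s, Complex.exp (G s) = X s) {a b : ℝ}
    (hab : Real.pi < |(G b).im - (G a).im|) (h0 : τ 0 = 0)
    (htop : ∀ s, (X s).im < (τ 1).im) (ha : ∀ t, (X a).im < (τ t).im)
    (hb : ∀ t, (X b).im < (τ t).im) : ∃ s t, X s = τ t := by
  by_contra! hne
  obtain ⟨g, hgc, hg⟩ := exists_continuous_exp_eq (E := ℝ × ℝ) (f := fun p => X p.1 - τ p.2)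
    (by fun_prop) (fun p => sub_ne_zero.2 (hne _ _))
  -- the logarithm that is continuous off the upper imaginary half-axis
  let ℓ : ℂ → ℂ := fun z => Complex.log (z * Complex.I)
  have hℓ : ∀ z : ℂ, z.im < 0 → Complex.exp (ℓ z) = z * Complex.I := by
    intro z hz
    refine Complex.exp_log (mul_ne_zero ?_ Complex.I_ne_zero)
    rintro rfl; simp at hz
  have hslit : ∀ z : ℂ, z.im < 0 → z * Complex.I ∈ Complex.slitPlane := by
    intro z hz
    left; simpa using hz
  have hℓc : ∀ u : ℝ → ℂ, Continuous u → (∀ t, (u t).im < 0) → Continuous fun t => ℓ (u t) :=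
    fun u hu h => (hu.mul continuous_const).clog fun t => hslit _ (h t)
  have himℓ : ∀ z : ℂ, z.im < 0 → |(ℓ z).im| < Real.pi / 2 := by
    intro z hz
    simp only [ℓ, Complex.log_im]
    exact Complex.abs_arg_lt_pi_div_two_iff.2 (Or.inl (by simpa using hz))
  have hGI : Complex.exp (Complex.log Complex.I) = Complex.I := Complex.exp_log Complex.I_ne_zero
  have hcol : ∀ c, (∀ t, (X c).im < (τ t).im) → ∀ t t',
      g (c, t) - ℓ (X c - τ t) = g (c, t') - ℓ (X c - τ t') := by
    intro c hc t t'
    have hneg : ∀ t, (X c - τ t).im < 0 := fun t => by simpa using hc t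
    have := sub_eq_sub_of_exp_eq (g := fun t => g (c, t) + Complex.log Complex.I)
      (h := fun t => ℓ (X c - τ t)) (by fun_prop) (hℓc _ (by fun_prop) hneg)
      (fun t => by rw [Complex.exp_add, hg, hGI, hℓ _ (hneg t)]) t t'
    linear_combination this
  have hbot : g (b, 0) - G b = g (a, 0) - G a :=
    sub_eq_sub_of_exp_eq (g := fun s => g (s, 0)) (h := G) (by fun_prop) hG
      (fun s => by rw [hg, hXG, h0, sub_zero]) b a
  have hneg : ∀ s, (X s - τ 1).im < 0 := fun s => by simpa using htop s
  have htp : g (b, 1) - ℓ (X b - τ 1) = g (a, 1) - ℓ (X a - τ 1) := by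
    have := sub_eq_sub_of_exp_eq (g := fun s => g (s, 1) + Complex.log Complex.I)
      (h := fun s => ℓ (X s - τ 1)) (by fun_prop) (hℓc _ (by fun_prop) hneg)
      (fun s => by rw [Complex.exp_add, hg, hGI, hℓ _ (hneg s)]) b a
    linear_combination this
  have hfin : G b - G a = ℓ (X b - τ 0) - ℓ (X a - τ 0) := by
    linear_combination -hbot + hcol b hb 0 1 - hcol a ha 0 1 + htp
  have h1 := himℓ (X b - τ 0) (by simpa using hb 0)
  have h2 := himℓ (X a - τ 0) (by simpa using ha 0)
  have h3 := congrArg Complex.im hfin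
  simp only [Complex.sub_im] at h3
  rw [h3] at hab
  rw [abs_lt] at h1 h2
  rcases abs_cases ((ℓ (X b - τ 0)).im - (ℓ (X a - τ 0)).im) with h | h <;> linarith

/-- A path that winds around `0` by more than a half turn, with both ends below `-2`, one of them
at its lowest point, differs from itself by a nonzero element of any `1`-dense subgroup. -/
theorem false_of_winding_of_translates_disjoint {X G : ℝ → ℂ} (hX : Continuous X)
    (hG : Continuous G) (hXG : ∀ s, Complex.exp (G s) = X s) {a b H : ℝ}
    (hab : Real.pi < |(G b).im - (G a).im|) (hmin : ∀ s, (X a).im ≤ (X s).im)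
    (ha : (X a).im < -2) (hb : (X b).im < -2) (hH : ∀ s, (X s).im < H) (hnorm : ∀ s, 1 ≤ ‖X s‖)
    {Λ : AddSubgroup ℂ} (hΛ : ∀ z, ∃ m ∈ Λ, ‖z - m‖ < 1)
    (hdisj : ∀ s t, X s - X t ∈ Λ → X s = X t) : False := by
  obtain ⟨m, hm, hPm⟩ := hΛ (X a)
  have him : |(X a - m).im| < 1 := (Complex.abs_im_le_norm _).trans_lt hPm
  rw [Complex.sub_im, abs_lt] at him
  have hm0 : m ≠ 0 := by
    rintro rfl
    simp at him; linarith
  let c : ℝ → ℝ := fun t => max 0 (min 1 t)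
  have hc : Continuous c := by fun_prop
  have hc0 : ∀ t ≤ 0, c t = 0 := fun t ht => by simp [c, ht]
  have hc1 : ∀ t, 1 ≤ t → c t = 1 := fun t ht => by simp [c, ht]
  have hcn : ∀ t, 0 ≤ c t := fun t => le_max_left _ _
  have hcl : ∀ t, c t ≤ 1 := fun t => max_le zero_le_one (min_le_left _ _)
  have hstep : ∀ τ : ℝ → ℂ, Continuous τ → (∀ t, (X a).im ≤ (τ t).im) → (∃ s, τ 0 = X s) →
      H ≤ (τ 1).im → ∃ s t, X s + m = τ t := by
    rintro τ hτ hlow ⟨s₀, hs₀⟩ htop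
    let σ : ℝ → ℂ := fun t => (c t : ℂ) * (X a - m) + (X (a + c (t - 1) * (s₀ - a)) - X a) +
      (τ (c (t - 2)) - τ 0)
    have hσ : Continuous σ := by fun_prop
    have hσ1 : ∀ t ≤ 1, σ t = (c t : ℂ) * (X a - m) := fun t ht => by
      simp [σ, hc0 (t - 1) (by linarith), hc0 (t - 2) (by linarith)]
    have hσ2 : ∀ t, 1 ≤ t → t ≤ 2 → σ t = X (a + c (t - 1) * (s₀ - a)) - m := fun t ht ht' => by
      simp [σ, hc1 t ht, hc0 (t - 2) (by linarith)]
    have hσ3 : ∀ t, 2 ≤ t → σ t = τ (c (t - 2)) - m := fun t ht => by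
      simp [σ, hc1 t (by linarith), hc1 (t - 1) (by linarith), hs₀]
    have hσlow : ∀ t, -1 ≤ (σ t).im := by
      intro t
      rcases le_total t 1 with h | h
      · rw [hσ1 t h, Complex.im_ofReal_mul , Complex.sub_im]
        nlinarith [hcn t, hcl t]
      rcases le_total t 2 with h' | h'
      · rw [hσ2 t h h', Complex.sub_im]
        linarith [hmin (a + c (t - 1) * (s₀ - a))]
      · rw [hσ3 t h', Complex.sub_im]
        linarith [hlow (c (t - 2))]
    obtain ⟨s, t, hst⟩ := exists_mem_of_winding (τ := fun t => σ (3 * t)) hX (by fun_prop) hG hXG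
      hab (by simp [hσ1 0 (by norm_num), hc0 0 le_rfl])
      (fun s => by
        have h : σ (3 * 1) = τ 1 - m := by
          rw [hσ3 _ (by norm_num), hc1 _ (by norm_num)]
        rw [h, Complex.sub_im]
        linarith [hH s])
      (fun t => by linarith [hσlow (3 * t)]) (fun t => by linarith [hσlow (3 * t)])
    rcases le_total (3 * t) 1 with h | h
    · exfalso
      rw [hσ1 _ h] at hst
      have h1 := hnorm s
      rw [hst, norm_mul, Complex.norm_real, Real.norm_of_nonneg (hcn _)] at h1
      nlinarith [hcn (3 * t), hcl (3 * t), norm_nonneg (X a - m)]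
    rcases le_total (3 * t) 2 with h' | h'
    · exfalso
      rw [hσ2 _ h h'] at hst
      have h1 : X (a + c (3 * t - 1) * (s₀ - a)) - X s = m := by rw [hst]; ring
      have h2 := hdisj _ _ (h1 ▸ hm)
      rw [h2, sub_self] at h1
      exact hm0 h1.symm
    · rw [hσ3 _ h'] at hst
      exact ⟨s, _, by rw [hst]; ring⟩
  have hind : ∀ k : ℕ, ∀ τ : ℝ → ℂ, Continuous τ → (∀ t, (X a).im ≤ (τ t).im) →
      (∃ s, τ 0 = X s) → H ≤ (τ 1).im → ∃ s t, X s + k * m = τ t := by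
    intro k
    induction k with
    | zero =>
      rintro τ - - ⟨s, hs⟩ -
      exact ⟨s, 0, by simp [hs]⟩
    | succ k ih =>
      intro τ hτ hlow h0 htop
      obtain ⟨s, t, hst⟩ := ih τ hτ hlow h0 htop
      have hk : ((k : ℂ) * m).im ≤ 0 := by
        rw [← Complex.ofReal_natCast, Complex.im_ofReal_mul]
        have : (0 : ℝ) ≤ k := k.cast_nonneg
        nlinarith
      obtain ⟨s', t', h'⟩ := hstep (fun r => τ (t + r * (1 - t)) - k * m) (by fun_prop)
        (fun r => by rw [Complex.sub_im]; linarith [hlow (t + r * (1 - t))])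
        ⟨s, by simp [← hst]⟩ (by simp only [one_mul, add_sub_cancel, Complex.sub_im]; linarith)
      exact ⟨s', t + t' * (1 - t), by push_cast; linear_combination h'⟩
  obtain ⟨k, hk⟩ := exists_nat_gt (H - (X a).im)
  obtain ⟨s, t, hst⟩ := hind k (fun t => X a + ((|t| * |H - (X a).im| : ℝ) : ℂ) * Complex.I)
    (by fun_prop)
    (fun t => by
      have : 0 ≤ |t| * |H - (X a).im| := by positivity
      simpa using this)
    ⟨a, by simp⟩
    (by
      have := le_abs_self (H - (X a).im)
      simp; linarith)
  have h1 := congrArg Complex.im hst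
  have h2 : 0 ≤ |t| * |H - (X a).im| := by positivity
  rw [Complex.add_im, ← Complex.ofReal_natCast, Complex.im_ofReal_mul] at h1
  have h3 : (X a).im ≤ (X s).im + k * m.im := by
    rw [h1]; simpa using h2
  have h4 : (k : ℝ) * m.im ≤ k * (-1) := by gcongr; linarith
  linarith [hH s]

/-! ### Displacements of equivariant maps -/

theorem norm_sub_round_lt_one (w : ℂ) : ‖w - (round w.re + round w.im * Complex.I)‖ < 1 := by
  have h3 := abs_le.1 (abs_sub_round w.re)
  have h4 := abs_le.1 (abs_sub_round w.im)
  have h5 : ‖w - (round w.re + round w.im * Complex.I)‖ ^ 2 =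
      (w.re - round w.re) ^ 2 + (w.im - round w.im) ^ 2 := by
    rw [← Complex.normSq_eq_norm_sq, Complex.normSq_apply]; simp; ring
  nlinarith [norm_nonneg (w - (round w.re + round w.im * Complex.I))]

/-- The argument of a doubly periodic nonvanishing function whose values surround `0` increases by
`π + η` between two points at distance less than `1`. -/
theorem exists_arg_increment_eq {φ g : ℂ → ℂ} (hg : Continuous g)
    (hφg : ∀ z, Complex.exp (g z) = φ z) (hφ1 : ∀ z, φ (z + 1) = φ z)
    (hφI : ∀ z, φ (z + Complex.I) = φ z) {η r M : ℝ} (hη0 : 0 < η) (hη : η < Real.pi)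
    (hM : ∀ z, ‖φ z‖ ≤ M) (hMr : M * Real.sin (η / 2) < r)
    (hdir : ∀ u : ℂ, ‖u‖ = 1 → ∃ z, r ≤ (u * φ z).re) :
    ∃ z₀ z₁, ‖z₁ - z₀‖ < 1 ∧ (g z₁).im - (g z₀).im = Real.pi + η := by
  by_contra! hne
  have hlt : ∀ z₀ z₁, ‖z₁ - z₀‖ < 1 → (g z₁).im - (g z₀).im < Real.pi + η := by
    intro z₀ z₁ hz
    by_contra! hge
    have hcont : Continuous fun t : ℝ => (g (z₀ + t * (z₁ - z₀))).im - (g z₀).im := by fun_prop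
    have hmem : Real.pi + η ∈ Set.Icc ((g (z₀ + (0 : ℝ) * (z₁ - z₀))).im - (g z₀).im)
        ((g (z₀ + (1 : ℝ) * (z₁ - z₀))).im - (g z₀).im) := by
      constructor
      · simp; linarith [Real.pi_pos]
      · simpa using hge
    obtain ⟨t, ht, hte⟩ := intermediate_value_Icc zero_le_one hcont.continuousOn hmem
    refine hne z₀ _ ?_ hte
    rw [add_sub_cancel_left, norm_mul, Complex.norm_real, Real.norm_of_nonneg ht.1]
    nlinarith [ht.1, ht.2, norm_nonneg (z₁ - z₀)]
  have hle : ∀ z v, ‖v‖ = 1 → (g (z + v)).im - (g z).im ≤ Real.pi + η := by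
    intro z v hv
    have hcont : Continuous fun t : ℝ => (g (z + t * v)).im - (g z).im := by fun_prop
    have h1 : Tendsto (fun t : ℝ => (g (z + t * v)).im - (g z).im) (𝓝[<] 1)
        (𝓝 ((g (z + v)).im - (g z).im)) := by
      have := hcont.continuousAt (x := 1)
      simp only [ContinuousAt, Complex.ofReal_one, one_mul] at this
      exact this.mono_left nhdsWithin_le_nhds
    refine le_of_tendsto h1 ?_
    filter_upwards [Ioo_mem_nhdsLT (show (0 : ℝ) < 1 by norm_num)] with t ht
    refine (hlt _ _ ?_).le
    rw [add_sub_cancel_left, norm_mul, hv, Complex.norm_real, Real.norm_of_nonneg ht.1.le, mul_one]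
    exact ht.2
  have hper : ∀ v, ‖v‖ = 1 → (∀ z, φ (z + v) = φ z) → ∀ z, (g (z + v)).im = (g z).im := by
    intro v hv hφv z
    have he : Complex.exp (g (z + v)) = Complex.exp (g z) := by rw [hφg, hφg, hφv]
    obtain ⟨m, hm⟩ := Complex.exp_eq_exp_iff_exists_int.1 he
    have him : (g (z + v)).im = (g z).im + m * (2 * Real.pi) := by rw [hm]; simp
    have h1 := hle z v hv
    have h2 := hle (z + v) (-v) (by rwa [norm_neg])
    rw [add_neg_cancel_right] at h2
    have hpi := Real.pi_pos
    have h3 : (m : ℝ) < 1 := by nlinarith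
    have h4 : (-1 : ℝ) < m := by nlinarith
    have h5 : m < 1 := by exact_mod_cast h3
    have h6 : -1 < m := by exact_mod_cast h4
    have : m = 0 := by omega
    simpa [this] using him
  have hp1 : Function.Periodic (fun z => (g z).im) 1 := hper 1 (by simp) hφ1
  have hpI : Function.Periodic (fun z => (g z).im) Complex.I := hper Complex.I (by simp) hφI
  have hall : ∀ z z', (g z).im - (g z').im < Real.pi + η := by
    intro z z'
    set w : ℂ := z' - z with hw
    have h1 : ∀ m n : ℤ, (g (z + (m + n * Complex.I))).im = (g z).im := by
      intro m n
      have := ((hpI.int_mul n) (z + m)).trans ((hp1.int_mul m) z |> fun h => by simpa using h)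
      simpa [add_assoc] using this
    rw [← h1 (round w.re) (round w.im)]
    refine hlt _ _ ?_
    have h2 : z + (round w.re + round w.im * Complex.I) - z' =
        -(w - (round w.re + round w.im * Complex.I)) := by rw [hw]; ring
    rw [h2, norm_neg]
    exact norm_sub_round_lt_one w
  have hbdd : BddBelow (Set.range fun z => (g z).im) := by
    refine ⟨(g 0).im - (Real.pi + η), ?_⟩
    rintro _ ⟨z, rfl⟩
    simp only
    linarith [hall 0 z]
  set A := ⨅ z, (g z).im with hA
  have hAl : ∀ z, A ≤ (g z).im := fun z => ciInf_le hbdd z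
  have hAu : ∀ z, (g z).im ≤ A + (Real.pi + η) := by
    intro z
    have : (g z).im - (Real.pi + η) ≤ A := le_ciInf fun z' => by linarith [hall z z']
    linarith
  set β := A + (Real.pi + η) / 2 with hβ
  obtain ⟨z, hz⟩ := hdir (-Complex.exp (-(β * Complex.I))) (by
    rw [norm_neg, ← neg_mul, ← Complex.ofReal_neg, Complex.norm_exp_ofReal_mul_I])
  have hval : (Complex.exp (-(β * Complex.I)) * φ z).re = ‖φ z‖ * Real.cos ((g z).im - β) := by
    rw [← hφg, ← Complex.exp_add, Complex.exp_re, Complex.norm_exp]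
    congr 2 <;> simp
    ring
  rw [neg_mul, Complex.neg_re, hval] at hz
  have hcos : -Real.sin (η / 2) ≤ Real.cos ((g z).im - β) := by
    rw [← Real.cos_add_pi_div_two, ← Real.cos_abs ((g z).im - β)]
    refine Real.cos_le_cos_of_nonneg_of_le_pi (abs_nonneg _) (by linarith) ?_
    rw [abs_le]
    constructor <;> linarith [hAl z, hAu z]
  have hs : 0 ≤ Real.sin (η / 2) := Real.sin_nonneg_of_nonneg_of_le_pi (by linarith) (by linarith)
  have h1 : ‖φ z‖ * -Real.sin (η / 2) ≤ ‖φ z‖ * Real.cos ((g z).im - β) := by gcongr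
  have h2 : ‖φ z‖ * Real.sin (η / 2) ≤ M * Real.sin (η / 2) := by gcongr; exact hM z
  linarith

/-- The displacement of an equivariant injective map cannot surround a large disc that it
avoids. -/
theorem false_of_displacement_surrounds {h : ℂ → ℂ} (hc : Continuous h)
    (hinj : Function.Injective h) {Λ : AddSubgroup ℂ}
    (hΛ : ∀ z, z ∈ Λ ↔ ∃ m n : ℤ, z = m + n * Complex.I)
    (hadd : ∀ z, ∀ v ∈ Λ, h (z + v) = h z + v) {η r M : ℝ} (hη0 : 0 < η) (hη : η < Real.pi)
    (hr : ∀ z, r ≤ ‖h z - z‖) (hM : ∀ z, ‖h z - z‖ ≤ M) (hMr : M * Real.sin (η / 2) < r)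
    (hr3 : 3 < r * Real.sin (η / 2))
    (hdir : ∀ u : ℂ, ‖u‖ = 1 → ∃ z, r ≤ (u * (h z - z)).re) : False := by
  have hs0 : 0 < Real.sin (η / 2) := Real.sin_pos_of_pos_of_lt_pi (by linarith) (by linarith)
  have hs1 := Real.sin_le_one (η / 2)
  have hr3' : 3 < r := by
    by_contra! hcon
    nlinarith
  set φ : ℂ → ℂ := fun z => h z - z with hφ
  have hφc : Continuous φ := by fun_prop
  have hφ0 : ∀ z, φ z ≠ 0 := fun z h0 => by
    have := hr z
    change r ≤ ‖φ z‖ at this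
    rw [h0, norm_zero] at this; linarith
  obtain ⟨g, hg, hφg⟩ := exists_continuous_exp_eq hφc hφ0
  have h1Λ : (1 : ℂ) ∈ Λ := (hΛ 1).2 ⟨1, 0, by simp⟩
  have hIΛ : Complex.I ∈ Λ := (hΛ _).2 ⟨0, 1, by simp⟩
  obtain ⟨z₀, z₁, hz, hang⟩ := exists_arg_increment_eq hg hφg
    (fun z => by simp only [hφ, hadd z 1 h1Λ]; ring)
    (fun z => by simp only [hφ, hadd z _ hIΛ]; ring) hη0 hη hM hMr hdir
  let c : ℝ → ℝ := fun t => max 0 (min 1 t)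
  have hcc : Continuous c := by fun_prop
  have hc0 : c 0 = 0 := by simp [c]
  have hc1 : c 1 = 1 := by simp [c]
  have hcn : ∀ t, 0 ≤ c t := fun t => le_max_left _ _
  have hcl : ∀ t, c t ≤ 1 := fun t => max_le zero_le_one (min_le_left _ _)
  have hcc' : ∀ t, c (c t) = c t := fun t => by
    simp only [c]
    rw [min_eq_right (hcl t), max_eq_right (hcn t)]
  let σ : ℝ → ℂ := fun s => z₀ + c s * (z₁ - z₀)
  have hσc : Continuous σ := by fun_prop
  have hσ : ∀ s, ‖σ s - z₀‖ < 1 := by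
    intro s
    simp only [σ, add_sub_cancel_left, norm_mul, Complex.norm_real, Real.norm_of_nonneg (hcn s)]
    nlinarith [hcn s, hcl s, norm_nonneg (z₁ - z₀)]
  set β := ((g z₀).im + (g z₁).im) / 2 with hβ
  set ω := Complex.exp (((Real.pi / 2 - β : ℝ) : ℂ) * Complex.I) with hω
  have hωn : ‖ω‖ = 1 := Complex.norm_exp_ofReal_mul_I _
  have hω0 : ω ≠ 0 := Complex.exp_ne_zero _
  let X : ℝ → ℂ := fun s => ω * (h (σ s) - z₀)
  have hX : Continuous X := by fun_prop
  have hsmall : ∀ s, ‖(σ s - z₀) / φ (σ s)‖ < 1 := by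
    intro s
    rw [norm_div, div_lt_one (norm_pos_iff.2 (hφ0 _))]
    have : r ≤ ‖φ (σ s)‖ := hr _
    linarith [hσ s]
  have hre : ∀ s, 0 < (1 + (σ s - z₀) / φ (σ s)).re := by
    intro s
    have := (abs_le.1 (Complex.abs_re_le_norm ((σ s - z₀) / φ (σ s)))).1
    rw [Complex.add_re, Complex.one_re]
    linarith [hsmall s]
  let G : ℝ → ℂ := fun s => g (σ s) + ((Real.pi / 2 - β : ℝ) : ℂ) * Complex.I +
    Complex.log (1 + (σ s - z₀) / φ (σ s))
  have hG : Continuous G := by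
    refine (by fun_prop : Continuous fun s => g (σ s) + ((Real.pi / 2 - β : ℝ) : ℂ) *
      Complex.I).add (Continuous.clog ?_ fun s => Or.inl (hre s))
    exact continuous_const.add ((hσc.sub continuous_const).div (hφc.comp hσc) fun s => hφ0 _)
  have hXG : ∀ s, Complex.exp (G s) = X s := by
    intro s
    have h0 : (1 + (σ s - z₀) / φ (σ s)) ≠ 0 := fun h0 => by
      have := hre s
      rw [h0] at this; simp at this
    simp only [G, X]
    rw [Complex.exp_add, Complex.exp_add, Complex.exp_log h0, hφg, ← hω]
    have := hφ0 (σ s)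
    field_simp
    simp only [hφ]; ring
  have hGim : ∀ s, |(G s).im - ((g (σ s)).im + (Real.pi / 2 - β))| < Real.pi / 2 := by
    intro s
    have : (G s).im - ((g (σ s)).im + (Real.pi / 2 - β)) =
        Complex.arg (1 + (σ s - z₀) / φ (σ s)) := by
      simp only [G, Complex.add_im, Complex.log_im, Complex.mul_im, Complex.ofReal_re,
        Complex.ofReal_im, Complex.I_re, Complex.I_im]
      ring
    rw [this]
    exact Complex.abs_arg_lt_pi_div_two_iff.2 (Or.inl (hre s))
  have hXim : ∀ s, (X s).im = ‖X s‖ * Real.sin (G s).im := by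
    intro s
    rw [← hXG s, Complex.exp_im, Complex.norm_exp]
  have hωφ : ∀ z, (ω * φ z).im = ‖φ z‖ * Real.sin ((g z).im + (Real.pi / 2 - β)) := by
    intro z
    rw [← hφg, hω, ← Complex.exp_add, Complex.exp_im, Complex.norm_exp]
    congr 2 <;> simp
    ring
  have hend : ∀ s, Real.sin ((g (σ s)).im + (Real.pi / 2 - β)) = - Real.sin (η / 2) →
      (X s).im < -2 := by
    intro s hs
    have h1 : X s = ω * φ (σ s) + ω * (σ s - z₀) := by simp only [X, hφ]; ring
    have h2 : (ω * (σ s - z₀)).im ≤ 1 := by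
      refine (le_abs_self _).trans ((Complex.abs_im_le_norm _).trans ?_)
      rw [norm_mul, hωn, one_mul]; exact (hσ s).le
    have h3 : r ≤ ‖φ (σ s)‖ := hr _
    rw [h1, Complex.add_im, hωφ, hs]
    nlinarith
  have hσ0 : σ 0 = z₀ := by simp [σ, hc0]
  have hσ1 : σ 1 = z₁ := by simp [σ, hc1]
  have hX0 : (X 0).im < -2 := by
    apply hend
    rw [hσ0, show (g z₀).im + (Real.pi / 2 - β) = -(η / 2) by rw [hβ]; linarith, Real.sin_neg]
  have hX1 : (X 1).im < -2 := by
    apply hend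
    rw [hσ1, show (g z₁).im + (Real.pi / 2 - β) = η / 2 + Real.pi by rw [hβ]; linarith,
      Real.sin_add_pi]
  have hnot : ∀ s, (X s).im < 0 → (G s).im < 0 ∨ Real.pi < (G s).im := by
    intro s hs
    by_contra! hcon
    have := Real.sin_nonneg_of_nonneg_of_le_pi hcon.1 hcon.2
    rw [hXim] at hs
    nlinarith [norm_nonneg (X s)]
  have hG0 : (G 0).im < 0 := by
    refine (hnot 0 (by linarith)).resolve_right ?_
    have := abs_lt.1 (hGim 0)
    rw [hσ0] at this
    have : (g z₀).im + (Real.pi / 2 - β) = -(η / 2) := by rw [hβ]; linarith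
    linarith
  have hG1 : Real.pi < (G 1).im := by
    refine (hnot 1 (by linarith)).resolve_left ?_
    have := abs_lt.1 (hGim 1)
    rw [hσ1] at this
    have : (g z₁).im + (Real.pi / 2 - β) = η / 2 + Real.pi := by rw [hβ]; linarith
    linarith
  have hXc : ∀ s, X (c s) = X s := fun s => by simp only [X, σ, hcc']
  have hcont : ContinuousOn (fun s => (X s).im) (Set.Icc 0 1) := by fun_prop
  obtain ⟨a, -, hamin⟩ := isCompact_Icc.exists_isMinOn ⟨0, by simp⟩ hcont
  obtain ⟨d, -, hdmax⟩ := isCompact_Icc.exists_isMaxOn ⟨0, by simp⟩ hcont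
  have hmin : ∀ s, (X a).im ≤ (X s).im := fun s => by
    have : (X a).im ≤ (X (c s)).im := hamin ⟨hcn s, hcl s⟩
    rwa [hXc] at this
  have hmax : ∀ s, (X s).im ≤ (X d).im := fun s => by
    have : (X (c s)).im ≤ (X d).im := hdmax ⟨hcn s, hcl s⟩
    rwa [hXc] at this
  have hXa : (X a).im < -2 := (hmin 0).trans_lt hX0
  obtain ⟨b, hb, hab⟩ : ∃ b, (X b).im < -2 ∧ Real.pi < |(G b).im - (G a).im| := by
    rcases hnot a (by linarith) with hlt | hgt
    · exact ⟨1, hX1, by rw [abs_of_pos] <;> linarith [Real.pi_pos]⟩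
    · exact ⟨0, hX0, by rw [abs_of_neg] <;> linarith [Real.pi_pos]⟩
  have hnorm : ∀ s, 1 ≤ ‖X s‖ := by
    intro s
    have h1 : h (σ s) - z₀ = φ (σ s) + (σ s - z₀) := by simp only [hφ]; ring
    have h2 : r ≤ ‖φ (σ s)‖ := hr _
    have h3 := norm_sub_le_norm_add (φ (σ s)) (σ s - z₀)
    simp only [X, norm_mul, hωn, one_mul, h1]
    linarith [hσ s]
  refine false_of_winding_of_translates_disjoint hX hG hXG hab hmin hXa hb
    (H := (X d).im + 1) (fun s => by linarith [hmax s]) hnorm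
    (Λ := Λ.map (AddMonoidHom.mulLeft ω)) ?_ ?_
  · intro z
    set w := ω⁻¹ * z with hw
    refine ⟨ω * (round w.re + round w.im * Complex.I), ⟨_, (hΛ _).2 ⟨_, _, rfl⟩, rfl⟩, ?_⟩
    have h2 : z - ω * (round w.re + round w.im * Complex.I) =
        ω * (w - (round w.re + round w.im * Complex.I)) := by rw [hw]; field_simp
    rw [h2, norm_mul, hωn, one_mul]
    exact norm_sub_round_lt_one w
  · rintro s t ⟨v, hv, hvX⟩
    have h1 : h (σ s) = h (σ t) + v := by
      have : ω * v = ω * (h (σ s) - h (σ t)) := by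
        change ω * v = _ at hvX
        rw [hvX]; simp only [X]; ring
      rw [mul_left_cancel₀ hω0 this]; ring
    rw [← hadd _ _ hv] at h1
    have h2 := hinj h1
    have h3 : ‖v‖ < 1 := by
      have : v = ((c s - c t : ℝ) : ℂ) * (z₁ - z₀) := by
        have : v = σ s - σ t := by rw [h2]; ring
        rw [this]; simp only [σ]; push_cast; ring
      rw [this, norm_mul, Complex.norm_real, Real.norm_eq_abs]
      have : |c s - c t| ≤ 1 := by
        rw [abs_le]; constructor <;> linarith [hcn s, hcn t, hcl s, hcl t]
      nlinarith [norm_nonneg (z₁ - z₀), abs_nonneg (c s - c t)]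
    have h4 : v = 0 := by
      obtain ⟨m, n, rfl⟩ := (hΛ v).1 hv
      have hm := (Complex.abs_re_le_norm ((m : ℂ) + n * Complex.I)).trans_lt h3
      have hn := (Complex.abs_im_le_norm ((m : ℂ) + n * Complex.I)).trans_lt h3
      simp at hm hn
      rw [← Int.cast_abs] at hm hn
      have hm' : |m| < 1 := by exact_mod_cast hm
      have hn' : |n| < 1 := by exact_mod_cast hn
      rw [Int.abs_lt_one_iff] at hm' hn'
      simp [hm', hn']
    simp only [X]
    rw [h2, h4, add_zero]

/-! ### Convexity of the rotation set -/

theorem orthonormalBasisOneI_mem_intLattice {z : ℂ} :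
    Complex.orthonormalBasisOneI.repr z ∈ intLattice ↔ ∃ m n : ℤ, z = m + n * Complex.I := by
  simp only [mem_intLattice, Fin.forall_fin_two, Complex.orthonormalBasisOneI_repr_apply,
    Matrix.cons_val_zero, Matrix.cons_val_one, Complex.ext_iff]
  simp

theorem IsEquivariant.interior_convexHull_subset (hF : IsEquivariant F) :
    interior (convexHull ℝ (rotationSet F)) ⊆ rotationSet F := by
  intro S hS
  by_contra hSρ
  obtain ⟨C, hC0, hC⟩ := hF.bounded
  obtain ⟨r₁, hr₁, hball₁⟩ := Metric.isOpen_iff.1 isOpen_interior S hS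
  obtain ⟨r₂, hr₂, hball₂⟩ := Metric.isOpen_iff.1
    (isClosed_rotationSet (F := F)).isOpen_compl S hSρ
  set r := min r₁ r₂ / 3 with hr
  have hr0 : 0 < r := by have := lt_min hr₁ hr₂; positivity
  have hr1 : 2 * r < r₁ := by linarith [min_le_left r₁ r₂]
  have hr2 : r < r₂ := by linarith [min_le_right r₁ r₂]
  -- the averaged displacements stay away from `S`
  have hfar : ∃ N : ℕ, ∀ n ≥ N, ∀ z, r ≤ ‖(n : ℝ)⁻¹ • (F^[n] z - z) - S‖ := by
    by_contra! hcon
    choose n hn z hz using hcon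
    obtain ⟨w, hw, φ, -, hlim⟩ :=
      hF.exists_subseq_mem_rotationSet (tendsto_atTop_mono hn tendsto_id) z
    have : ‖w - S‖ ≤ r :=
      le_of_tendsto (hlim.sub_const S).norm (Eventually.of_forall fun k => (hz (φ k)).le)
    exact hball₂ (by rw [Metric.mem_ball, dist_eq_norm]; linarith) hw
  obtain ⟨N, hN⟩ := hfar
  set M := C + ‖S‖ + r with hM
  have hM0 : 0 < M := by positivity
  set η := min 1 (r / M) with hη
  have hη0 : 0 < η := lt_min one_pos (by positivity)
  have hη1 : η ≤ 1 := min_le_left _ _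
  have hpi := Real.pi_gt_three
  have hsin0 : 0 < Real.sin (η / 2) := Real.sin_pos_of_pos_of_lt_pi (by linarith) (by linarith)
  have hsin1 : M * Real.sin (η / 2) < r := by
    have h1 := Real.sin_lt (x := η / 2) (by linarith)
    have h2 : η ≤ r / M := min_le_right _ _
    rw [le_div_iff₀ hM0] at h2
    nlinarith
  obtain ⟨n₀, hn₀⟩ := exists_nat_gt (3 / (r * Real.sin (η / 2)))
  set n := max (max N n₀) 1 with hn
  have hnN : N ≤ n := (le_max_left _ _).trans (le_max_left _ _)
  have hnn₀ : (n₀ : ℝ) ≤ n := by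
    exact_mod_cast (le_max_right N n₀).trans (le_max_left _ _)
  have hn0 : (0 : ℝ) < n := by
    have : 1 ≤ n := le_max_right _ _
    exact_mod_cast this
  have hn3 : 3 < n * r * Real.sin (η / 2) := by
    rw [div_lt_iff₀ (by positivity)] at hn₀
    have : (n₀ : ℝ) * (r * Real.sin (η / 2)) ≤ n * (r * Real.sin (η / 2)) := by gcongr
    linarith
  set e := Complex.orthonormalBasisOneI.repr with he
  have hdisp : ∀ z, e.symm (F^[n] (e z) - (n : ℝ) • S) - z =
      e.symm (F^[n] (e z) - e z - (n : ℝ) • S) := by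
    intro z
    simp only [map_sub, e.symm_apply_apply]; ring
  have hscale : ∀ x, F^[n] x - x - (n : ℝ) • S =
      (n : ℝ) • ((n : ℝ)⁻¹ • (F^[n] x - x) - S) := by
    intro x
    rw [smul_sub, smul_smul, mul_inv_cancel₀ hn0.ne', one_smul]
  have hFn := hF.iterate n
  refine false_of_displacement_surrounds (h := fun z => e.symm (F^[n] (e z) - (n : ℝ) • S))
    (Λ := intLattice.comap (e.toLinearEquiv : ℂ →+ Plane)) (η := η) (r := n * r) (M := n * M)
    ?_ ?_ ?_ ?_ hη0 (by linarith) ?_ ?_ ?_ hn3 ?_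
  · exact e.symm.continuous.comp ((hFn.continuous.comp e.continuous).sub continuous_const)
  · intro z z' h
    exact e.injective (hFn.injective (sub_left_injective (e.symm.injective h)))
  · intro z
    exact orthonormalBasisOneI_mem_intLattice
  · intro z v hv
    have hv' : e v ∈ intLattice := hv
    simp only [map_add, hFn.map_add_lattice _ _ hv', map_sub, e.symm_apply_apply]
    ring
  · intro z
    rw [hdisp, LinearIsometryEquiv.norm_map, hscale, norm_smul, Real.norm_natCast]
    gcongr
    exact hN n hnN _
  · intro z
    rw [hdisp, LinearIsometryEquiv.norm_map, hscale, norm_smul, Real.norm_natCast]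
    gcongr
    refine (norm_sub_le _ _).trans ?_
    linarith [norm_inv_smul_le hC0 hC n (e z)]
  · nlinarith
  · intro u hu
    by_contra! hcon
    let L : Plane →L[ℝ] ℝ := Complex.reCLM.comp
      ((ContinuousLinearMap.mul ℝ ℂ u).comp (e.symm.toContinuousLinearEquiv : Plane →L[ℝ] ℂ))
    have hL : ∀ x, L x = (u * e.symm x).re := fun _ => rfl
    have hLle : ∀ x, L (F^[n] x - x) ≤ n * (L S + r) := by
      intro x
      have := hcon (e.symm x)
      rw [hdisp, e.apply_symm_apply, ← hL, map_sub, map_smul, smul_eq_mul] at this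
      linarith
    have hρ : rotationSet F ⊆ {x | L x ≤ L S + r} := by
      intro w hw
      exact le_of_mul_le_mul_left (hF.apply_smul_le L hLle hw) hn0
    have hconv : convexHull ℝ (rotationSet F) ⊆ {x | L x ≤ L S + r} :=
      convexHull_min hρ (convex_halfSpace_le L.isLinear _)
    have hd : S + (2 * r) • e (starRingEnd ℂ u) ∈ convexHull ℝ (rotationSet F) := by
      refine interior_subset (hball₁ ?_)
      rw [Metric.mem_ball, dist_eq_norm, add_sub_cancel_left, norm_smul,
        LinearIsometryEquiv.norm_map, RCLike.norm_conj, hu, Real.norm_of_nonneg (by positivity)]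
      linarith
    have h1 : L (S + (2 * r) • e (starRingEnd ℂ u)) ≤ L S + r := hconv hd
    have h2 : L (e (starRingEnd ℂ u)) = 1 := by
      rw [hL, e.symm_apply_apply, Complex.mul_conj, Complex.normSq_eq_norm_sq, hu]; simp
    rw [map_add, map_smul, h2, smul_eq_mul] at h1
    linarith

/-- The rotation set of an equivariant injective map of the plane is convex. -/
theorem IsEquivariant.convex_rotationSet (hF : IsEquivariant F) :
    Convex ℝ (rotationSet F) := by
  by_cases hinter : (interior (convexHull ℝ (rotationSet F))).Nonempty
  · have hsub : convexHull ℝ (rotationSet F) ⊆ rotationSet F := by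
      calc convexHull ℝ (rotationSet F) ⊆ closure (convexHull ℝ (rotationSet F)) := subset_closure
        _ = closure (interior (convexHull ℝ (rotationSet F))) :=
          ((convex_convexHull ℝ _).closure_interior_eq_closure_of_nonempty_interior hinter).symm
        _ ⊆ rotationSet F :=
          closure_minimal hF.interior_convexHull_subset isClosed_rotationSet
    rw [← hsub.antisymm (subset_convexHull ℝ _)]
    exact convex_convexHull ℝ _
  rw [interior_convexHull_nonempty_iff_affineSpan_eq_top] at hinter
  have hdir : (affineSpan ℝ (rotationSet F)).direction < ⊤ := by
    refine lt_top_iff_ne_top.2 fun h => hinter ?_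
    rwa [AffineSubspace.direction_eq_top_iff_of_nonempty
      (hF.rotationSet_nonempty.affineSpan ℝ)] at h
  obtain ⟨ℓ, hℓ0, hℓ⟩ := Submodule.exists_le_ker_of_lt_top _ hdir
  have hconst : ∀ a ∈ rotationSet F, ∀ b ∈ rotationSet F, ℓ a = ℓ b := by
    intro a ha b hb
    have := hℓ (AffineSubspace.vsub_mem_direction (subset_affineSpan ℝ _ ha)
      (subset_affineSpan ℝ _ hb))
    rwa [vsub_eq_sub, LinearMap.mem_ker, map_sub, sub_eq_zero] at this
  rw [convex_iff_segment_subset]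
  intro a ha b hb
  rw [segment_eq_image_lineMap]
  rintro _ ⟨t, ht, rfl⟩
  rcases eq_or_ne a b with rfl | hab
  · simpa using ha
  rcases ht.1.eq_or_lt with rfl | ht0
  · simpa using ha
  rcases ht.2.eq_or_lt with rfl | ht1
  · simpa using hb
  set S := AffineMap.lineMap a b t with hS
  have hS' : S = a + t • (b - a) := by rw [hS, AffineMap.lineMap_apply]; simp [add_comm]
  let J : Plane →L[ℝ] ℝ := innerSL ℝ (b - a)
  have hJ : ∀ x, J x = inner ℝ (b - a) x := fun _ => rfl
  have hJpos : 0 < J (b - a) := by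
    rw [hJ, real_inner_self_eq_norm_sq]
    have := norm_pos_iff.2 (sub_ne_zero.2 hab.symm)
    positivity
  have hJS : J S = J a + t * J (b - a) := by rw [hS', map_add, map_smul, smul_eq_mul]
  have hJb : J b = J a + J (b - a) := by rw [← map_add]; simp
  have hex : ∀ n : ℕ, ∃ z, J (F^[n + 1] z - z) = ((n + 1 : ℕ) : ℝ) * J S := by
    intro n
    have hn : (0 : ℝ) < ((n + 1 : ℕ) : ℝ) := by positivity
    have hc : Continuous fun z => J (F^[n + 1] z - z) :=
      J.continuous.comp ((hF.continuous.iterate _).sub continuous_id)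
    refine mem_range_of_exists_le_of_exists_ge hc ?_ ?_
    · by_contra! hcon
      have := hF.apply_smul_le (-J) (n := n + 1) (c := -(((n + 1 : ℕ) : ℝ) * J S))
        (fun z => neg_le_neg (hcon z).le) ha
      rw [neg_apply] at this
      nlinarith [mul_pos hn (mul_pos ht0 hJpos)]
    · by_contra! hcon
      have := hF.apply_smul_le J (n := n + 1) (c := ((n + 1 : ℕ) : ℝ) * J S)
        (fun z => (hcon z).le) hb
      nlinarith [mul_pos hn (mul_pos (sub_pos.2 ht1) hJpos)]
  choose z hz using hex
  obtain ⟨w, hw, φ, -, hlim⟩ :=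
    hF.exists_subseq_mem_rotationSet (n := fun n => n + 1) (tendsto_add_atTop_nat 1) z
  have hJw : J w = J S := by
    refine tendsto_nhds_unique ((J.continuous.tendsto w).comp hlim) ?_
    refine tendsto_const_nhds.congr fun k => ?_
    have hn : ((φ k + 1 : ℕ) : ℝ) ≠ 0 := by positivity
    simp only [Function.comp_apply, map_smul, smul_eq_mul, hz]
    field_simp
  have hℓw : ℓ (w - S) = 0 := by
    rw [map_sub, hS', map_add, map_smul, map_sub, hconst w hw a ha, hconst b hb a ha]; simp
  have hℓab : ℓ (b - a) = 0 := by rw [map_sub, hconst b hb a ha, sub_self]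
  have hJwS : J (w - S) = 0 := by rw [map_sub, hJw, sub_self]
  have hws : w - S = 0 := by
    have hℓe : ∀ x : Plane, ℓ x = x 0 * ℓ (EuclideanSpace.single 0 1) +
        x 1 * ℓ (EuclideanSpace.single 1 1) := by
      intro x
      conv_lhs => rw [show x = x 0 • EuclideanSpace.single (0 : Fin 2) (1 : ℝ) +
        x 1 • EuclideanSpace.single (1 : Fin 2) (1 : ℝ) by ext i; fin_cases i <;> simp]
      rw [map_add, map_smul, map_smul, smul_eq_mul, smul_eq_mul]
    set p := ℓ (EuclideanSpace.single 0 1)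
    set q := ℓ (EuclideanSpace.single 1 1)
    have hpq : p ≠ 0 ∨ q ≠ 0 := by
      by_contra! h
      exact hℓ0 (LinearMap.ext fun x => by rw [hℓe, h.1, h.2]; simp)
    rw [hℓe] at hℓw hℓab
    rw [hJ, PiLp.inner_apply] at hJwS
    rw [hJ, PiLp.inner_apply] at hJpos
    simp only [Fin.sum_univ_two, RCLike.inner_apply, conj_trivial] at hJwS hJpos
    generalize w - S = X at *
    generalize b - a = Y at *
    have hdet : X 0 * Y 1 - X 1 * Y 0 = 0 := by
      rcases hpq with hp | hq
      · refine (mul_eq_zero.1 (?_ : p * (X 0 * Y 1 - X 1 * Y 0) = 0)).resolve_left hp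
        linear_combination Y 1 * hℓw - X 1 * hℓab
      · refine (mul_eq_zero.1 (?_ : q * (X 0 * Y 1 - X 1 * Y 0) = 0)).resolve_left hq
        linear_combination X 0 * hℓab - Y 0 * hℓw
    ext i
    fin_cases i
    · refine (mul_eq_zero.1 (?_ : (Y 0 * Y 0 + Y 1 * Y 1) * X 0 = 0)).resolve_left hJpos.ne'
      linear_combination Y 0 * hJwS + Y 1 * hdet
    · refine (mul_eq_zero.1 (?_ : (Y 0 * Y 0 + Y 1 * Y 1) * X 1 = 0)).resolve_left hJpos.ne'
      linear_combination Y 1 * hJwS - Y 0 * hdet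
  rwa [← sub_eq_zero.1 hws]

/-! ### Decomposing pseudo-orbits into loops -/

theorem mem_intLattice_of_mem_span {v : Plane}
    (hv : v ∈ Submodule.span ℤ (Set.range (EuclideanSpace.basisFun (Fin 2) ℝ).toBasis)) :
    v ∈ intLattice := by
  rw [Module.Basis.mem_span_iff_repr_mem] at hv
  intro i
  obtain ⟨m, hm⟩ := hv i
  exact ⟨m, by simpa using hm.symm⟩

/-- Disjoint discs of radius `b / 2` in the torus have total area at most `1`. -/
theorem card_mul_le_one {ι : Type*} (T : Finset ι) (p : ι → Plane) {b : ℝ} (hb0 : 0 < b)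
    (hb1 : b ≤ 1) (hsep : ∀ i ∈ T, ∀ j ∈ T, i ≠ j → ∀ v ∈ intLattice, b ≤ ‖p i - p j - v‖) :
    T.card * (Real.pi * (b / 2) ^ 2) ≤ 1 := by
  by_contra! hcon
  set B := (EuclideanSpace.basisFun (Fin 2) ℝ).toBasis with hB
  set s : Set Plane := ⋃ i ∈ T, Metric.ball (p i) (b / 2) with hs
  have hsm : MeasurableSet s := T.measurableSet_biUnion fun i _ => Metric.isOpen_ball.measurableSet
  have hvol : volume s = ENNReal.ofReal (T.card * (Real.pi * (b / 2) ^ 2)) := by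
    rw [hs, measure_biUnion_finset _ fun i _ => Metric.isOpen_ball.measurableSet]
    · simp_rw [EuclideanSpace.volume_ball_fin_two]
      rw [Finset.sum_const, nsmul_eq_mul, ENNReal.ofReal_mul (by positivity),
        ENNReal.ofReal_natCast, mul_comm Real.pi, ENNReal.ofReal_mul (by positivity),
        ENNReal.ofReal_pow (by positivity)]
    · intro i hi j hj hij
      refine Metric.ball_disjoint_ball ?_
      have := hsep i hi j hj hij 0 (zero_mem _)
      rw [sub_zero, ← dist_eq_norm] at this
      linarith
  have hfund : volume (ZSpan.fundamentalDomain B) = 1 := by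
    rw [measure_congr (ZSpan.fundamentalDomain_ae_parallelepiped B volume), hB]
    simpa using (EuclideanSpace.basisFun (Fin 2) ℝ).volume_parallelepiped
  have : Countable (Submodule.span ℤ (Set.range B)).toAddSubgroup :=
    inferInstanceAs (Countable (Submodule.span ℤ (Set.range B)))
  obtain ⟨x, y, hxy, hnd⟩ := exists_pair_mem_lattice_not_disjoint_vadd
    (ZSpan.isAddFundamentalDomain' B volume) hsm.nullMeasurableSet
    (by rw [hfund, hvol]; exact ENNReal.one_lt_ofReal.2 hcon)
  obtain ⟨_, ⟨a, ha, rfl⟩, ⟨c, hc, hac⟩⟩ := Set.not_disjoint_iff.1 hnd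
  change (y : Plane) + c = x + a at hac
  have hx : (x : Plane) ∈ intLattice := mem_intLattice_of_mem_span x.2
  have hy : (y : Plane) ∈ intLattice := mem_intLattice_of_mem_span y.2
  simp only [hs, Set.mem_iUnion, Metric.mem_ball, dist_eq_norm, exists_prop] at ha hc
  obtain ⟨i, hi, hai⟩ := ha
  obtain ⟨j, hj, hcj⟩ := hc
  have hlt : ‖p i - p j - (y - x)‖ < b := by
    have : p i - p j - (y - x) = (c - p j) - (a - p i) := by
      rw [show c = (x : Plane) + a - y by rw [← hac]; abel]; abel
    rw [this]
    linarith [norm_sub_le (c - p j) (a - p i)]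
  rcases eq_or_ne i j with rfl | hij
  · rw [sub_self, zero_sub, norm_neg] at hlt
    have := eq_zero_of_mem_intLattice (sub_mem hy hx) (hlt.trans_le hb1)
    exact hxy (Subtype.ext (sub_eq_zero.1 this).symm)
  · exact absurd (hsep i hi j hj hij _ (sub_mem hy hx)) (not_le.2 hlt)

/-- If all approximate loops of a sequence have displacement in the corresponding multiples of a
convex set `A`, and all steps are close to `A`, then the total displacement is close to a multiple
of `A`. -/
theorem exists_mem_smul_norm_sub_le {A : Set Plane} (hA : Convex ℝ A) (hne : A.Nonempty)
    (x : ℕ → Plane) (n : ℕ) {b κ : ℝ} (hb0 : 0 < b) (hb1 : b ≤ 1) (hκ : 0 ≤ κ)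
    (hloop : ∀ i j, i < j → j ≤ n → ∀ v ∈ intLattice, ‖x j - x i - v‖ < b →
      v ∈ ((j - i : ℕ) : ℝ) • A)
    (hstep : ∀ i < n, ∃ a ∈ A, ‖x (i + 1) - x i - a‖ ≤ κ) :
    ∃ p ∈ (n : ℝ) • A, ‖x n - x 0 - p‖ ≤ 4 / (Real.pi * b ^ 2) * (b + κ) := by
  have hzero : (0 : Plane) ∈ ((0 : ℕ) : ℝ) • A := by
    obtain ⟨a, ha⟩ := hne
    exact ⟨a, ha, by simp⟩
  have hadd : ∀ (k l : ℕ) (p q : Plane), p ∈ (k : ℝ) • A → q ∈ (l : ℝ) • A →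
      p + q ∈ ((k + l : ℕ) : ℝ) • A := by
    intro k l p q hp hq
    push_cast
    rw [hA.add_smul k.cast_nonneg l.cast_nonneg]
    exact Set.add_mem_add hp hq
  have hmain : ∀ d s, s + d = n → ∃ T : Finset ℕ, (∀ i ∈ T, s ≤ i ∧ i ≤ n) ∧
      (∀ i ∈ T, ∀ j ∈ T, i ≠ j → ∀ v ∈ intLattice, b ≤ ‖x i - x j - v‖) ∧
      ∃ p ∈ (d : ℝ) • A, ‖x n - x s - p‖ ≤ T.card * (b + κ) := by
    intro d
    induction d using Nat.strong_induction_on with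
    | _ d ih =>
    intro s hs
    classical
    -- the last return close to `x s`
    let R : Finset ℕ := (Finset.Icc s n).filter fun j => ∃ v ∈ intLattice, ‖x j - x s - v‖ < b
    have hsR : s ∈ R := by
      simp only [R, Finset.mem_filter, Finset.mem_Icc]
      exact ⟨⟨le_rfl, by omega⟩, 0, zero_mem _, by simpa using hb0⟩
    set e := R.max' ⟨s, hsR⟩ with he
    have heR : e ∈ R := R.max'_mem _
    have hmax : ∀ j, e < j → j ≤ n → ∀ v ∈ intLattice, b ≤ ‖x j - x s - v‖ := by
      intro j hj hjn v hv
      by_contra! hlt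
      have hse : s ≤ e := R.le_max' _ hsR
      have : j ∈ R := by
        simp only [R, Finset.mem_filter, Finset.mem_Icc]
        exact ⟨⟨by omega, hjn⟩, v, hv, hlt⟩
      exact absurd (R.le_max' _ this) (not_le.2 hj)
    simp only [R, Finset.mem_filter, Finset.mem_Icc] at heR
    obtain ⟨⟨hse, hen⟩, v, hv, hve⟩ := heR
    have hvA : v ∈ ((e - s : ℕ) : ℝ) • A := by
      rcases hse.eq_or_lt with h | h
      · rw [← h] at hve ⊢
        rw [sub_self, zero_sub, norm_neg] at hve
        rw [eq_zero_of_mem_intLattice hv (hve.trans_le hb1), Nat.sub_self]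
        exact hzero
      · exact hloop s e h hen v hv hve
    rcases hen.eq_or_lt with h | h
    · refine ⟨{s}, by simp; omega, by simp, v, ?_, ?_⟩
      · rwa [show d = e - s by omega]
      · rw [← h]
        simp only [Finset.card_singleton, Nat.cast_one, one_mul]
        linarith
    · obtain ⟨T, hT, hsep, p, hp, hnorm⟩ := ih (n - (e + 1)) (by omega) (e + 1) (by omega)
      obtain ⟨a, ha, hstep⟩ := hstep e h
      have hsT : s ∉ T := fun hmem => by have := (hT s hmem).1; omega
      refine ⟨insert s T, ?_, ?_, v + a + p, ?_, ?_⟩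
      · intro i hi
        rcases Finset.mem_insert.1 hi with rfl | hi
        · exact ⟨le_rfl, by omega⟩
        · have := hT i hi; omega
      · intro i hi j hj hij w hw
        rcases Finset.mem_insert.1 hi with rfl | hi' <;>
          rcases Finset.mem_insert.1 hj with rfl | hj'
        · exact absurd rfl hij
        · have := hmax j (by have := (hT j hj').1; omega) (hT j hj').2 (-w) (neg_mem hw)
          rwa [← norm_neg, show -(x j - x i - -w) = x i - x j - w by abel] at this
        · exact hmax i (by have := (hT i hi').1; omega) (hT i hi').2 w hw
        · exact hsep i hi' j hj' hij w hw
      · have h1 := hadd _ 1 v a hvA ⟨a, ha, by simp⟩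
        have h2 := hadd _ _ _ _ h1 hp
        rwa [show e - s + 1 + (n - (e + 1)) = d by omega] at h2
      · rw [Finset.card_insert_of_notMem hsT]
        have : x n - x s - (v + a + p) =
            (x e - x s - v) + (x (e + 1) - x e - a) + (x n - x (e + 1) - p) := by abel
        rw [this]
        refine (norm_add₃_le).trans ?_
        push_cast
        linarith
  obtain ⟨T, -, hsep, p, hp, hnorm⟩ := hmain n 0 (zero_add n)
  refine ⟨p, hp, hnorm.trans ?_⟩
  have hcard := card_mul_le_one T x hb0 hb1 hsep
  have hpi := Real.pi_pos
  gcongr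
  rw [le_div_iff₀ (by positivity)]
  linarith

/-! ### Area-preserving twists of the plane -/

theorem hasDerivAt_max_zero_sq (y : ℝ) :
    HasDerivAt (fun y : ℝ => (max 0 y) ^ 2) (2 * max 0 y) y := by
  rcases lt_trichotomy y 0 with hy | rfl | hy
  · rw [max_eq_left hy.le, mul_zero]
    refine (hasDerivAt_const y (0 : ℝ)).congr_of_eventuallyEq ?_
    filter_upwards [gt_mem_nhds hy] with z hz
    simp [hz.le]
  · rw [max_self, mul_zero]
    have h : (fun y : ℝ => (max 0 y) ^ 2) =O[𝓝 0] fun y => ‖y - 0‖ ^ 2 := by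
      refine Asymptotics.IsBigO.of_bound 1 (Eventually.of_forall fun y => ?_)
      rw [sub_zero, Real.norm_of_nonneg (by positivity), Real.norm_of_nonneg (by positivity),
        one_mul]
      gcongr
      exact max_le (norm_nonneg _) (Real.le_norm_self y)
    simpa using (h.hasFDerivAt one_lt_two).hasDerivAt
  · rw [max_eq_right hy.le]
    refine (by simpa using hasDerivAt_pow 2 y : HasDerivAt (fun y : ℝ => y ^ 2) (2 * y) y)
      |>.congr_of_eventuallyEq ?_
    filter_upwards [lt_mem_nhds hy] with z hz
    rw [max_eq_right hz.le]

/-- The angle of the twist as a function of the squared radius in units of `R ^ 2`. -/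
noncomputable def twistProfile (w : ℝ) : ℝ := (max 0 (5 - w)) ^ 2 / 16

theorem continuous_twistProfile : Continuous twistProfile := by
  unfold twistProfile; fun_prop

theorem twistProfile_nonneg (w : ℝ) : 0 ≤ twistProfile w := by unfold twistProfile; positivity

theorem twistProfile_one : twistProfile 1 = 1 := by norm_num [twistProfile]

theorem twistProfile_of_le {w : ℝ} (hw : 5 ≤ w) : twistProfile w = 0 := by
  simp [twistProfile, hw]

theorem hasDerivAt_twistProfile (w : ℝ) : ∃ d, HasDerivAt twistProfile d w :=
  ⟨_, ((hasDerivAt_max_zero_sq (5 - w)).comp w ((hasDerivAt_id w).const_sub 5)).div_const 16⟩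

theorem mul_twistProfile_sq_le {s : ℝ} (hs : 0 ≤ s) : s * twistProfile (s ^ 2) ≤ 1 := by
  rcases le_total 5 (s ^ 2) with h | h
  · rw [twistProfile_of_le h]; simp
  · rw [twistProfile, max_eq_right (by linarith)]
    have h1 : 0 ≤ (s - 1) ^ 2 * (s * (5 - s ^ 2) + 2 * (5 - s ^ 2) + 2 * s + 6) := by
      have := sub_nonneg.2 h
      positivity
    nlinarith

/-- The twist of the plane about `0` that rotates the circle of radius `R` by the angle `a`. -/
noncomputable def twist (a R : ℝ) (z : ℂ) : ℂ :=
  z * Complex.exp ((a * twistProfile (Complex.normSq z / R ^ 2) : ℝ) * Complex.I)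

theorem norm_twist (a R : ℝ) (z : ℂ) : ‖twist a R z‖ = ‖z‖ := by
  rw [twist, norm_mul, Complex.norm_exp_ofReal_mul_I, mul_one]

theorem normSq_twist (a R : ℝ) (z : ℂ) : Complex.normSq (twist a R z) = Complex.normSq z := by
  rw [Complex.normSq_eq_norm_sq, norm_twist, Complex.normSq_eq_norm_sq]

theorem twist_twist_neg (a R : ℝ) (z : ℂ) : twist a R (twist (-a) R z) = z := by
  rw [twist, normSq_twist, twist, mul_assoc, ← Complex.exp_add]
  have : ((-a * twistProfile (Complex.normSq z / R ^ 2) : ℝ) : ℂ) * Complex.I +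
    ((a * twistProfile (Complex.normSq z / R ^ 2) : ℝ) : ℂ) * Complex.I = 0 := by
    push_cast; ring
  rw [this, Complex.exp_zero, mul_one]

theorem twist_neg_twist (a R : ℝ) (z : ℂ) : twist (-a) R (twist a R z) = z := by
  simpa using twist_twist_neg (-a) R z

theorem twist_zero (R : ℝ) (z : ℂ) : twist 0 R z = z := by simp [twist]

theorem continuous_twist (R : ℝ) : Continuous fun p : ℝ × ℂ => twist p.1 R p.2 := by
  unfold twist
  have := continuous_twistProfile
  have := Complex.continuous_normSq
  fun_prop

theorem twist_of_le (a : ℝ) {R : ℝ} (hR : 0 < R) {z : ℂ} (hz : 3 * R ≤ ‖z‖) :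
    twist a R z = z := by
  rw [twist, twistProfile_of_le]
  · simp
  · rw [le_div_iff₀ (by positivity), Complex.normSq_eq_norm_sq]
    nlinarith

theorem twist_of_norm_eq (a : ℝ) {R : ℝ} (hR : 0 < R) {z : ℂ} (hz : ‖z‖ = R) :
    twist a R z = z * Complex.exp (a * Complex.I) := by
  rw [twist, Complex.normSq_eq_norm_sq, hz, div_self (by positivity), twistProfile_one, mul_one]

theorem norm_twist_sub_le {a R : ℝ} (ha : 0 ≤ a) (hR : 0 < R) (z : ℂ) :
    ‖twist a R z - z‖ ≤ a * R := by
  set θ := a * twistProfile (Complex.normSq z / R ^ 2) with hθ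
  have h1 : twist a R z - z = z * (Complex.exp (Complex.I * θ) - 1) := by
    rw [twist, ← hθ, mul_comm Complex.I]; ring
  have h2 : ‖Complex.exp (Complex.I * θ) - 1‖ ≤ θ := by
    have := Real.norm_exp_I_mul_ofReal_sub_one_le (x := θ)
    rwa [Real.norm_of_nonneg (mul_nonneg ha (twistProfile_nonneg _))] at this
  have h3 : ‖z‖ / R * twistProfile ((‖z‖ / R) ^ 2) ≤ 1 := mul_twistProfile_sq_le (by positivity)
  rw [h1, norm_mul]
  calc ‖z‖ * ‖Complex.exp (Complex.I * θ) - 1‖ ≤ ‖z‖ * θ := by gcongr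
    _ = a * R * (‖z‖ / R * twistProfile ((‖z‖ / R) ^ 2)) := by
      rw [hθ, Complex.normSq_eq_norm_sq, div_pow]; field_simp
    _ ≤ a * R * 1 := by gcongr
    _ = a * R := mul_one _

theorem det_twist_derivative {E z : ℂ} (hE : ‖E‖ = 1) (κ : ℝ) (T : ℂ →L[ℝ] ℂ)
    (hT : ∀ h, T h = E * (h + z * Complex.I * (κ * (z.re * h.re + z.im * h.im) : ℝ))) :
    T.det = 1 := by
  have hE' : E.re * E.re + E.im * E.im = 1 := by
    rw [← Complex.normSq_apply, Complex.normSq_eq_norm_sq, hE, one_pow]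
  rw [ContinuousLinearMap.det, ← LinearMap.det_toMatrix Complex.basisOneI, Matrix.det_fin_two]
  simp only [LinearMap.toMatrix_apply, Complex.coe_basisOneI, Complex.coe_basisOneI_repr,
    ContinuousLinearMap.coe_coe, hT, Matrix.cons_val_zero, Matrix.cons_val_one]
  simp
  linear_combination hE'

theorem exists_hasFDerivAt_twist (a R : ℝ) (z : ℂ) :
    ∃ T : ℂ →L[ℝ] ℂ, HasFDerivAt (twist a R) T z ∧ T.det = 1 := by
  obtain ⟨d, hd⟩ := hasDerivAt_twistProfile (Complex.normSq z / R ^ 2)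
  have hn : HasFDerivAt (fun z : ℂ => Complex.normSq z)
      ((2 * z.re) • Complex.reCLM + (2 * z.im) • Complex.imCLM) z := by
    have h1 := (Complex.reCLM.hasFDerivAt (x := z)).mul (Complex.reCLM.hasFDerivAt (x := z))
    have h2 := (Complex.imCLM.hasFDerivAt (x := z)).mul (Complex.imCLM.hasFDerivAt (x := z))
    refine (h1.add h2).congr_fderiv ?_ |>.congr_of_eventuallyEq ?_
    · ext; simp; ring
    · exact Eventually.of_forall fun w => by simp [Complex.normSq_apply]
  have hn' : HasFDerivAt (fun z : ℂ => Complex.normSq z / R ^ 2)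
      ((R ^ 2)⁻¹ • ((2 * z.re) • Complex.reCLM + (2 * z.im) • Complex.imCLM)) z := by
    simpa [div_eq_mul_inv, mul_comm] using hn.const_mul (R ^ 2)⁻¹
  have hθ := (hd.comp_hasFDerivAt z hn').const_mul a
  have hθc := Complex.ofRealCLM.hasFDerivAt.comp z hθ
  have hE := (hθc.mul_const Complex.I).cexp
  have hT := (hasFDerivAt_id z).mul hE
  refine ⟨_, hT, ?_⟩
  refine det_twist_derivative (E := Complex.exp ((a * twistProfile (Complex.normSq z / R ^ 2) : ℝ) *
    Complex.I)) (z := z) (Complex.norm_exp_ofReal_mul_I _) (2 * a * d * (R ^ 2)⁻¹) _ fun h => ?_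
  simp
  ring

theorem measurePreserving_twist (a R : ℝ) : MeasurePreserving (twist a R) := by
  have hc : ∀ a, Continuous (twist a R) := fun a =>
    (continuous_twist R).comp (continuous_const.prodMk continuous_id)
  refine ⟨(hc a).measurable, ?_⟩
  ext s hs
  rw [Measure.map_apply (hc a).measurable hs]
  have himg : twist a R ⁻¹' s = twist (-a) R '' s := by
    ext z
    constructor
    · intro hz
      exact ⟨_, hz, twist_neg_twist a R z⟩
    · rintro ⟨w, hw, rfl⟩
      simpa [twist_twist_neg] using hw
  choose T hT hdet using exists_hasFDerivAt_twist (-a) R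
  rw [himg, ← lintegral_abs_det_fderiv_eq_addHaar_image volume hs
    (fun z _ => (hT z).hasFDerivWithinAt)
    ((Function.LeftInverse.injective (twist_twist_neg a R)).injOn)]
  simp [hdet]

/-! ### Descending equivariant maps to the torus -/

/-- The map of the torus induced by a map of the plane. -/
noncomputable def descend (P : Plane → Plane) (y : Torus) : Torus :=
  proj (P (Function.surjInv proj_surjective y))

theorem descend_proj {P : Plane → Plane} (hP : ∀ x, ∀ v ∈ intLattice, P (x + v) = P x + v)
    (x : Plane) : descend P (proj x) = proj (P x) := by
  rw [descend, proj_eq_proj_iff]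
  have h := proj_eq_proj_iff.1 (Function.surjInv_eq proj_surjective (proj x))
  have h2 := hP x _ h
  rw [add_sub_cancel] at h2
  rw [h2, add_sub_cancel_left]
  exact h

theorem continuous_descend {A : Type*} [TopologicalSpace A] {P : A → Plane → Plane}
    (hP : ∀ a x, ∀ v ∈ intLattice, P a (x + v) = P a x + v)
    (hc : Continuous fun p : A × Plane => P p.1 p.2) :
    Continuous fun p : A × Torus => descend (P p.1) p.2 := by
  have hq : IsOpenQuotientMap (Prod.map id proj : A × Plane → A × Torus) :=
    IsOpenQuotientMap.id.prodMap isOpenQuotientMap_proj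
  rw [hq.isQuotientMap.continuous_iff]
  refine (continuous_proj.comp hc).congr fun p => ?_
  simp [descend_proj (hP p.1)]

/-- The homeomorphism of the torus induced by a homeomorphism of the plane that commutes with
integer translations. -/
noncomputable def descendHomeomorph (P Q : Plane → Plane) (hPc : Continuous P) (hQc : Continuous Q)
    (hP : ∀ x, ∀ v ∈ intLattice, P (x + v) = P x + v)
    (hQ : ∀ x, ∀ v ∈ intLattice, Q (x + v) = Q x + v)
    (hPQ : ∀ x, P (Q x) = x) (hQP : ∀ x, Q (P x) = x) : Torus ≃ₜ Torus where
  toFun := descend P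
  invFun := descend Q
  left_inv y := by
    obtain ⟨x, rfl⟩ := proj_surjective y
    rw [descend_proj hP, descend_proj hQ, hQP]
  right_inv y := by
    obtain ⟨x, rfl⟩ := proj_surjective y
    rw [descend_proj hQ, descend_proj hP, hPQ]
  continuous_toFun := by
    have := continuous_descend (A := Unit) (P := fun _ => P) (fun _ => hP)
      (hPc.comp continuous_snd)
    exact this.comp (continuous_const.prodMk continuous_id : Continuous fun y : Torus => ((), y))
  continuous_invFun := by
    have := continuous_descend (A := Unit) (P := fun _ => Q) (fun _ => hQ)
      (hQc.comp continuous_snd)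
    exact this.comp (continuous_const.prodMk continuous_id : Continuous fun y : Torus => ((), y))

/-! ### Periodic twists -/

theorem roundVec_add (x : Plane) {v : Plane} (hv : v ∈ intLattice) :
    roundVec (x + v) = roundVec x + v := by
  ext i
  obtain ⟨m, hm⟩ := hv i
  simp [roundVec_apply, hm]

theorem roundVec_eq_zero {x : Plane} (hx : ‖x‖ < 1 / 2) : roundVec x = 0 := by
  ext i
  have := abs_lt.1 ((abs_apply_le_norm x i).trans_lt hx)
  have : round (x i) = 0 := by
    rw [round_eq_zero_iff]
    constructor <;> linarith
  simp [roundVec_apply, this]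

/-- The twist of `ℂ` transported to the plane. -/
noncomputable def planeTwist (a R : ℝ) (x : Plane) : Plane :=
  Complex.orthonormalBasisOneI.repr (twist a R (Complex.orthonormalBasisOneI.repr.symm x))

theorem norm_planeTwist (a R : ℝ) (x : Plane) : ‖planeTwist a R x‖ = ‖x‖ := by
  rw [planeTwist, LinearIsometryEquiv.norm_map, norm_twist, LinearIsometryEquiv.norm_map]

theorem planeTwist_planeTwist_neg (a R : ℝ) (x : Plane) :
    planeTwist a R (planeTwist (-a) R x) = x := by
  rw [planeTwist, planeTwist, LinearIsometryEquiv.symm_apply_apply, twist_twist_neg,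
    LinearIsometryEquiv.apply_symm_apply]

theorem planeTwist_of_le (a : ℝ) {R : ℝ} (hR : 0 < R) {x : Plane} (hx : 3 * R ≤ ‖x‖) :
    planeTwist a R x = x := by
  rw [planeTwist, twist_of_le a hR (by rwa [LinearIsometryEquiv.norm_map]),
    LinearIsometryEquiv.apply_symm_apply]

theorem norm_planeTwist_sub_le {a R : ℝ} (ha : 0 ≤ a) (hR : 0 < R) (x : Plane) :
    ‖planeTwist a R x - x‖ ≤ a * R := by
  have := norm_twist_sub_le ha hR (Complex.orthonormalBasisOneI.repr.symm x)
  rwa [← LinearIsometryEquiv.norm_map Complex.orthonormalBasisOneI.repr, map_sub,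
    LinearIsometryEquiv.apply_symm_apply] at this

theorem continuous_planeTwist (R : ℝ) : Continuous fun p : ℝ × Plane => planeTwist p.1 R p.2 :=
  Complex.orthonormalBasisOneI.repr.continuous.comp ((continuous_twist R).comp
    (continuous_fst.prodMk (Complex.orthonormalBasisOneI.repr.symm.continuous.comp continuous_snd)))

theorem continuous_planeTwist_comp {A : Type*} [TopologicalSpace A] (R : ℝ) {s : A → ℝ}
    {g : A → Plane} (hs : Continuous s) (hg : Continuous g) :
    Continuous fun t => planeTwist (s t) R (g t) := by
  have h := (continuous_planeTwist R).comp (hs.prodMk hg)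
  simpa only [Function.comp_def] using h

theorem measurePreserving_planeTwist (a R : ℝ) : MeasurePreserving (planeTwist a R) :=
  Complex.orthonormalBasisOneI.measurePreserving_repr.comp
    ((measurePreserving_twist a R).comp
      Complex.orthonormalBasisOneI.measurePreserving_repr_symm)

/-- The twist about `0` repeated periodically. -/
noncomputable def periodicTwist (a R : ℝ) (x : Plane) : Plane :=
  roundVec x + planeTwist a R (x - roundVec x)

theorem periodicTwist_add (a R : ℝ) (x : Plane) {v : Plane} (hv : v ∈ intLattice) :
    periodicTwist a R (x + v) = periodicTwist a R x + v := by
  rw [periodicTwist, roundVec_add x hv, add_sub_add_right_eq_sub, periodicTwist]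
  abel

theorem periodicTwist_of_le {R : ℝ} (hR : 0 < R) (a : ℝ) {x : Plane}
    (hx : 3 * R ≤ ‖x - roundVec x‖) :
    periodicTwist a R x = x := by
  rw [periodicTwist, planeTwist_of_le a hR hx, add_sub_cancel]

theorem roundVec_periodicTwist {R : ℝ} (hR : 0 < R) (hR' : 6 * R ≤ 1) (a : ℝ) (x : Plane) :
    roundVec (periodicTwist a R x) = roundVec x := by
  rcases lt_or_ge ‖x - roundVec x‖ (3 * R) with h | h
  · rw [periodicTwist, add_comm, roundVec_add _ (roundVec_mem x), roundVec_eq_zero, zero_add]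
    rw [norm_planeTwist]; linarith
  · rw [periodicTwist_of_le hR a h]

theorem periodicTwist_periodicTwist_neg {R : ℝ} (hR : 0 < R) (hR' : 6 * R ≤ 1) (a : ℝ) (x : Plane) :
    periodicTwist a R (periodicTwist (-a) R x) = x := by
  rw [periodicTwist, roundVec_periodicTwist hR hR', periodicTwist, add_sub_cancel_left,
    planeTwist_planeTwist_neg, add_sub_cancel]

theorem periodicTwist_of_lt (a R : ℝ) {v x : Plane} (hv : v ∈ intLattice) (hx : ‖x - v‖ < 1 / 2) :
    periodicTwist a R x = v + planeTwist a R (x - v) := by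
  have : roundVec x = v := by
    have := roundVec_add (x - v) hv
    rwa [sub_add_cancel, roundVec_eq_zero hx, zero_add] at this
  rw [periodicTwist, this]

theorem continuous_norm_sub_roundVec : Continuous fun x : Plane => ‖x - roundVec x‖ := by
  have h : ∀ x : Plane, ‖x - roundVec x‖ = √(∑ i, ‖proj x i‖ ^ 2) := by
    intro x
    rw [EuclideanSpace.norm_eq]
    congr 1
    refine Finset.sum_congr rfl fun i _ => ?_
    rw [proj, UnitAddCircle.norm_eq]; rfl
  simp_rw [h]
  have := continuous_proj
  fun_prop

theorem continuous_periodicTwist {R : ℝ} (hR : 0 < R) (hR' : 6 * R < 1) :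
    Continuous fun p : ℝ × Plane => periodicTwist p.1 R p.2 := by
  rw [continuous_iff_continuousAt]
  rintro ⟨a, x⟩
  rcases lt_or_ge ‖x - roundVec x‖ (1 / 2) with h | h
  · have hc : Continuous fun p : ℝ × Plane => roundVec x + planeTwist p.1 R (p.2 - roundVec x) :=
      continuous_const.add (continuous_planeTwist_comp R continuous_fst
        (continuous_snd.sub continuous_const))
    refine hc.continuousAt.congr ?_
    have hopen : IsOpen {p : ℝ × Plane | ‖p.2 - roundVec x‖ < 1 / 2} :=
      isOpen_lt (by fun_prop) continuous_const
    filter_upwards [hopen.mem_nhds h] with p hp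
    exact (periodicTwist_of_lt p.1 R (roundVec_mem x) hp).symm
  · refine continuous_snd.continuousAt.congr ?_
    have hopen : IsOpen {p : ℝ × Plane | 3 * R < ‖p.2 - roundVec p.2‖} :=
      isOpen_lt continuous_const (continuous_norm_sub_roundVec.comp continuous_snd)
    filter_upwards [hopen.mem_nhds (show 3 * R < ‖x - roundVec x‖ by linarith)] with p hp
    exact (periodicTwist_of_le hR p.1 (le_of_lt hp)).symm

theorem continuous_periodicTwist_left (a : ℝ) {R : ℝ} (hR : 0 < R) (hR' : 6 * R < 1) :
    Continuous (periodicTwist a R) := by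
  have h := (continuous_periodicTwist hR hR').comp (Continuous.prodMk_right a)
  simpa only [Function.comp_def] using h

theorem continuous_descend_periodicTwist {R : ℝ} (hR : 0 < R) (hR' : 6 * R < 1) :
    Continuous fun p : ℝ × Torus => descend (periodicTwist p.1 R) p.2 :=
  continuous_descend (P := fun a => periodicTwist a R)
    (fun a x _ hv => periodicTwist_add a R x hv) (continuous_periodicTwist hR hR')

/-- The half-open unit square centred at `0`. -/
def unitBox : Set Plane := {x | ∀ i, x i ∈ Set.Ioc (-(1 / 2) : ℝ) (1 / 2)}

theorem measurableSet_unitBox : MeasurableSet unitBox := by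
  have : unitBox = ⋂ i, (fun x : Plane => x i) ⁻¹' Set.Ioc (-(1 / 2) : ℝ) (1 / 2) := by
    ext x; simp [unitBox]
  rw [this]
  exact MeasurableSet.iInter fun i =>
    (by fun_prop : Measurable fun x : Plane => x i) measurableSet_Ioc

theorem measurePreserving_proj : MeasurePreserving proj (volume.restrict unitBox) volume := by
  have h1 : MeasurePreserving (fun (x : Fin 2 → ℝ) i => (x i : UnitAddCircle))
      (Measure.pi fun _ : Fin 2 => (volume : Measure ℝ).restrict (Set.Ioc (-(1 / 2)) (1 / 2)))
      (Measure.pi fun _ : Fin 2 => (volume : Measure UnitAddCircle)) := by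
    refine measurePreserving_pi _ _ fun _ => ?_
    have := UnitAddCircle.measurePreserving_mk (-(1 / 2))
    rwa [show (-(1 / 2) + 1 : ℝ) = 1 / 2 by norm_num] at this
  rw [← Measure.restrict_pi_pi] at h1
  have h2 := (PiLp.volume_preserving_ofLp (Fin 2)).restrict_preimage
    (MeasurableSet.univ_pi fun _ : Fin 2 =>
      (measurableSet_Ioc : MeasurableSet (Set.Ioc (-(1 / 2) : ℝ) (1 / 2))))
  have h3 := h1.comp h2
  have hbox : (WithLp.ofLp : Plane → Fin 2 → ℝ) ⁻¹'
      (Set.univ.pi fun _ : Fin 2 => Set.Ioc (-(1 / 2) : ℝ) (1 / 2)) = unitBox := by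
    ext x; simp [unitBox]
  rw [hbox] at h3
  exact h3

theorem mem_unitBox_of_norm_lt {x : Plane} (hx : ‖x‖ < 1 / 2) : x ∈ unitBox := fun i => by
  have := abs_lt.1 ((abs_apply_le_norm x i).trans_lt hx)
  exact ⟨this.1, this.2.le⟩

theorem norm_sub_roundVec_of_mem_unitBox {x : Plane} (hx : x ∈ unitBox) :
    ‖x - roundVec x‖ = ‖x‖ := by
  rw [EuclideanSpace.norm_eq, EuclideanSpace.norm_eq]
  congr 1
  refine Finset.sum_congr rfl fun i _ => ?_
  congr 1
  have h1 : ‖(x - roundVec x) i‖ = ‖((x i : ℝ) : UnitAddCircle)‖ := by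
    rw [UnitAddCircle.norm_eq]; rfl
  rw [h1, (AddCircle.norm_coe_eq_abs_iff (p := (1 : ℝ)) one_ne_zero).2, Real.norm_eq_abs]
  rw [abs_one, abs_le]
  exact ⟨(hx i).1.le, (hx i).2⟩

theorem measurePreserving_descend_periodicTwist (a : ℝ) {R : ℝ} (hR : 0 < R) (hR' : 6 * R < 1) :
    MeasurePreserving (descend (periodicTwist a R)) volume volume := by
  have hadd : ∀ x, ∀ v ∈ intLattice, periodicTwist a R (x + v) = periodicTwist a R x + v :=
    fun x v hv => periodicTwist_add a R x hv
  have hcd : Continuous (descend (periodicTwist a R)) := by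
    have h := (continuous_descend_periodicTwist hR hR').comp (Continuous.prodMk_right a)
    simpa only [Function.comp_def] using h
  have hbox : planeTwist a R ⁻¹' unitBox = unitBox := by
    ext x
    rcases lt_or_ge ‖x‖ (1 / 2) with h | h
    · exact iff_of_true (mem_unitBox_of_norm_lt (by rwa [norm_planeTwist]))
        (mem_unitBox_of_norm_lt h)
    · rw [Set.mem_preimage, planeTwist_of_le a hR (by linarith)]
  have hT := (measurePreserving_planeTwist a R).restrict_preimage measurableSet_unitBox
  rw [hbox] at hT
  have heq : ∀ x ∈ unitBox, periodicTwist a R x = planeTwist a R x := by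
    intro x hx
    rcases lt_or_ge ‖x‖ (1 / 2) with h | h
    · rw [periodicTwist, roundVec_eq_zero h, sub_zero, zero_add]
    · rw [periodicTwist_of_le hR a (by rw [norm_sub_roundVec_of_mem_unitBox hx]; linarith),
        planeTwist_of_le a hR (by linarith)]
  refine ⟨hcd.measurable, ?_⟩
  conv_lhs => rw [← measurePreserving_proj.map_eq]
  rw [Measure.map_map hcd.measurable continuous_proj.measurable,
    ← (measurePreserving_proj.comp hT).map_eq]
  refine Measure.map_congr ?_
  filter_upwards [ae_restrict_mem measurableSet_unitBox] with x hx
  rw [Function.comp_apply, descend_proj hadd, heq x hx, Function.comp_apply]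

/-- The homeomorphism of the torus induced by a periodic twist. -/
noncomputable def torusTwist (a : ℝ) {R : ℝ} (hR : 0 < R) (hR' : 6 * R < 1) : Torus ≃ₜ Torus :=
  descendHomeomorph (periodicTwist a R) (periodicTwist (-a) R)
    (continuous_periodicTwist_left a hR hR') (continuous_periodicTwist_left (-a) hR hR')
    (fun x _ hv => periodicTwist_add a R x hv) (fun x _ hv => periodicTwist_add (-a) R x hv)
    (periodicTwist_periodicTwist_neg hR hR'.le a)
    (fun x => by simpa using periodicTwist_periodicTwist_neg hR hR'.le (-a) x)

theorem torusTwist_apply (a : ℝ) {R : ℝ} (hR : 0 < R) (hR' : 6 * R < 1) (y : Torus) :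
    torusTwist a hR hR' y = descend (periodicTwist a R) y := rfl

theorem isLift_torusTwist (a : ℝ) {R : ℝ} (hR : 0 < R) (hR' : 6 * R < 1) :
    IsLift (periodicTwist a R) (torusTwist a hR hR') :=
  ⟨continuous_periodicTwist_left a hR hR', fun x => by
    rw [torusTwist_apply, descend_proj fun x _ hv => periodicTwist_add a R x hv]⟩

theorem periodicTwist_zero (R : ℝ) (x : Plane) : periodicTwist 0 R x = x := by
  rw [periodicTwist, planeTwist, twist_zero, LinearIsometryEquiv.apply_symm_apply, add_sub_cancel]

theorem torusTwist_mem_Homeo0Area (a : ℝ) {R : ℝ} (hR : 0 < R) (hR' : 6 * R < 1) :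
    torusTwist a hR hR' ∈ Homeo0Area := by
  refine ⟨⟨fun t => torusTwist (t * a) hR hR', ?_, ?_, by simp⟩,
    measurePreserving_descend_periodicTwist a hR hR'⟩
  · have := (continuous_descend_periodicTwist hR hR').comp (by fun_prop :
      Continuous fun p : unitInterval × Torus => ((p.1 : ℝ) * a, p.2))
    simpa only [torusTwist_apply, Function.comp_def] using this
  · ext1 y
    obtain ⟨x, rfl⟩ := proj_surjective y
    rw [← (isLift_torusTwist _ hR hR').2]
    simp [periodicTwist_zero]

/-- Conjugation by a translation preserves `Homeo0Area`. -/
theorem conj_mem_Homeo0Area {φ : Torus ≃ₜ Torus} (hφ : φ ∈ Homeo0Area) (c : Torus) :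
    ((Homeomorph.addRight (-c)).trans φ).trans (Homeomorph.addRight c) ∈ Homeo0Area := by
  obtain ⟨⟨h, hc, h0, h1⟩, hm⟩ := hφ
  refine ⟨⟨fun t => ((Homeomorph.addRight (-c)).trans (h t)).trans (Homeomorph.addRight c),
    ?_, ?_, ?_⟩, ?_⟩
  · exact (hc.comp (by fun_prop :
      Continuous fun p : unitInterval × Torus => (p.1, p.2 + -c))).add continuous_const
  · ext1 y; simp [h0]
  · simp only [h1]
  · exact (measurePreserving_add_right volume c).comp
      (hm.comp (measurePreserving_add_right volume (-c)))

/-- A point can be moved by a small vector with an area-preserving map supported near the point,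
without displacing other points by much more. -/
theorem exists_local_move (p u : Plane) {α r : ℝ} (hα0 : 0 < α) (hα1 : α < 1)
    (hr : r ≤ 1 / 2) (hu : 4 * ‖u‖ ≤ r * ‖Complex.exp (α * Complex.I) - 1‖) :
    ∃ φ ∈ Homeo0Area, ∃ Ψ, IsLift Ψ φ ∧ Ψ p = p + u ∧ (∀ x, ‖Ψ x - x‖ ≤ ‖u‖ / (1 - α)) ∧
      ∀ x, (∀ v ∈ intLattice, r ≤ ‖x - p - v‖) → Ψ x = x := by
  rcases eq_or_ne u 0 with rfl | hu0
  · exact ⟨_, refl_mem_Homeo0Area, id, isLift_id, by simp, by simp, fun _ _ => rfl⟩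
  set ω := Complex.exp (α * Complex.I) - 1 with hω
  have hωn : α * (1 - α) ≤ ‖ω‖ := by
    have h1 : ‖(α * Complex.I : ℂ)‖ = α := by simp [abs_of_pos hα0]
    have h2 := Complex.norm_exp_sub_one_sub_id_le (x := α * Complex.I) (by rw [h1]; exact hα1.le)
    rw [h1, ← hω] at h2
    have h3 := norm_sub_norm_le (α * Complex.I : ℂ) ω
    rw [h1, norm_sub_rev _ ω] at h3
    linarith
  have hωpos : 0 < ‖ω‖ := (mul_pos hα0 (sub_pos.2 hα1)).trans_le hωn
  have hω0 : ω ≠ 0 := norm_pos_iff.1 hωpos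
  have hupos : 0 < ‖u‖ := norm_pos_iff.2 hu0
  set R := ‖u‖ / ‖ω‖ with hR
  have hR0 : 0 < R := by positivity
  have hR4 : 4 * R ≤ r := by
    rw [hR, mul_div_assoc', div_le_iff₀ hωpos]; exact hu
  have hR6 : 6 * R < 1 := by linarith
  set e := Complex.orthonormalBasisOneI.repr with he
  set y : Plane := e (e.symm u / ω) with hy
  have hyn : ‖y‖ = R := by
    rw [hy, LinearIsometryEquiv.norm_map, norm_div, LinearIsometryEquiv.norm_map]
  set c := p - y with hc
  refine ⟨_, conj_mem_Homeo0Area (torusTwist_mem_Homeo0Area α hR0 hR6) (proj c),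
    fun x => periodicTwist α R (x - c) + c, ⟨?_, ?_⟩, ?_, ?_, ?_⟩
  · exact ((isLift_torusTwist α hR0 hR6).1.comp (continuous_id.sub continuous_const)).add
      continuous_const
  · intro x
    rw [proj_add, (isLift_torusTwist α hR0 hR6).2, proj_sub, sub_eq_add_neg]
    rfl
  · simp only
    rw [show p - c = y by rw [hc]; abel, periodicTwist, roundVec_eq_zero (by rw [hyn]; linarith),
      sub_zero, zero_add, planeTwist, ← he, twist_of_norm_eq α hR0
        (by rw [LinearIsometryEquiv.norm_map, hyn]), hy, e.symm_apply_apply]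
    have h1 : e.symm u / ω * Complex.exp (α * Complex.I) = e.symm u / ω + e.symm u := by
      rw [show Complex.exp (α * Complex.I) = ω + 1 by rw [hω]; ring]
      field_simp
      ring
    rw [h1, map_add, e.apply_symm_apply, hc, hy]
    abel
  · intro x
    have h1 : periodicTwist α R (x - c) + c - x = planeTwist α R (x - c - roundVec (x - c)) -
        (x - c - roundVec (x - c)) := by
      rw [periodicTwist]; abel
    simp only [h1]
    refine (norm_planeTwist_sub_le hα0.le hR0 _).trans ?_
    rw [hR, le_div_iff₀ (sub_pos.2 hα1), mul_div_assoc', div_mul_eq_mul_div, div_le_iff₀ hωpos]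
    nlinarith
  · intro x hx
    simp only
    rw [periodicTwist_of_le hR0, sub_add_cancel]
    have h1 := hx _ (roundVec_mem (x - c))
    have h2 : x - p - roundVec (x - c) = (x - c - roundVec (x - c)) - y := by
      rw [hc]; abel
    rw [h2] at h1
    linarith [norm_sub_le (x - c - roundVec (x - c)) y]

/-! ### Moving finitely many points by area-preserving maps -/

/-- `Ψ` is a lift of an area-preserving homeomorphism isotopic to the identity that displaces
points by at most `D`. -/
def IsAreaMove (D : ℝ) (Ψ : Plane → Plane) : Prop :=
  (∃ φ ∈ Homeo0Area, IsLift Ψ φ) ∧ ∀ x, ‖Ψ x - x‖ ≤ D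

theorem IsAreaMove.comp {D D' : ℝ} {Ψ Ψ' : Plane → Plane} (h : IsAreaMove D Ψ)
    (h' : IsAreaMove D' Ψ') : IsAreaMove (D + D') (Ψ ∘ Ψ') := by
  obtain ⟨⟨φ, hφ, hl⟩, hd⟩ := h
  obtain ⟨⟨φ', hφ', hl'⟩, hd'⟩ := h'
  refine ⟨⟨_, Homeo0Area.trans hφ' hφ, hl.comp hl'⟩, fun x => ?_⟩
  have : (Ψ ∘ Ψ') x - x = (Ψ (Ψ' x) - Ψ' x) + (Ψ' x - x) := by simp
  rw [this]
  exact (norm_add_le _ _).trans (add_le_add (hd _) (hd' _))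

theorem isAreaMove_id {D : ℝ} (hD : 0 ≤ D) : IsAreaMove D id :=
  ⟨⟨_, refl_mem_Homeo0Area, isLift_id⟩, fun x => by simpa using hD⟩

theorem exists_pos_forall_le {ι : Type*} [Finite ι] (f : ι → ℝ) (hf : ∀ i, 0 < f i) :
    ∃ r > 0, ∀ i, r ≤ f i := by
  rcases isEmpty_or_nonempty ι with h | h
  · exact ⟨1, one_pos, fun i => h.elim i⟩
  · obtain ⟨i, hi⟩ := Finite.exists_min f
    exact ⟨f i, hf i, hi⟩

theorem norm_sub_roundVec_le (x : Plane) {v : Plane} (hv : v ∈ intLattice) :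
    ‖x - roundVec x‖ ≤ ‖x - v‖ := by
  rw [EuclideanSpace.norm_eq, EuclideanSpace.norm_eq]
  refine Real.sqrt_le_sqrt (Finset.sum_le_sum fun i _ => ?_)
  refine pow_le_pow_left₀ (norm_nonneg _) ?_ 2
  obtain ⟨m, hm⟩ := hv i
  simpa [roundVec_apply, hm] using round_le (x i) m

theorem exists_pos_le_norm_sub {x : Plane} (hx : x ∉ intLattice) :
    ∃ r > 0, ∀ v ∈ intLattice, r ≤ ‖x - v‖ := by
  refine ⟨‖x - roundVec x‖, norm_pos_iff.2 fun h => hx ?_, fun v hv => norm_sub_roundVec_le x hv⟩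
  rw [sub_eq_zero.1 h]
  exact roundVec_mem x

/-- Several well separated points can be moved simultaneously by small vectors. -/
theorem exists_simultaneous_move {ι : Type*} (S : Finset ι) (p u : ι → Plane) {α r U : ℝ}
    (hα0 : 0 < α) (hα1 : α < 1) (hr0 : 0 < r) (hr : r ≤ 1 / 2) (hU0 : 0 ≤ U)
    (hsep : ∀ i j, i ≠ j → ∀ v ∈ intLattice, 2 * r ≤ ‖p i - p j - v‖) (hu : ∀ i, ‖u i‖ ≤ U)
    (hU : 4 * U ≤ r * ‖Complex.exp (α * Complex.I) - 1‖) :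
    ∃ Ψ, IsAreaMove (U / (1 - α)) Ψ ∧ (∀ i ∈ S, Ψ (p i) = p i + u i) ∧
      ∀ x, (∀ i ∈ S, ∀ v ∈ intLattice, r ≤ ‖x - p i - v‖) → Ψ x = x := by
  classical
  have hα : 0 < 1 - α := sub_pos.2 hα1
  induction S using Finset.induction_on with
  | empty => exact ⟨id, isAreaMove_id (by positivity), by simp, fun _ _ => rfl⟩
  | insert j S hj ih =>
    obtain ⟨Ψ, hΨ, hmove, hsupp⟩ := ih
    obtain ⟨φ, hφ, Θ, hΘl, hΘp, hΘd, hΘs⟩ := exists_local_move (p j) (u j) hα0 hα1 hr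
      ((mul_le_mul_of_nonneg_left (hu j) (by norm_num)).trans hU)
    obtain ⟨ψ, hψ, hΨl⟩ := hΨ.1
    have hinj : Function.Injective Ψ := hΨl.injective hψ.1
    have hfix : ∀ x, (∃ v ∈ intLattice, ‖x - p j - v‖ < r) → Ψ x = x := by
      rintro x ⟨v, hv, hxv⟩
      refine hsupp x fun i hi w hw => ?_
      by_contra! hlt
      have hij : i ≠ j := fun h => hj (h ▸ hi)
      have h1 := hsep i j hij (v - w) (sub_mem hv hw)
      have h2 : p i - p j - (v - w) = (x - p j - v) - (x - p i - w) := by abel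
      rw [h2] at h1
      linarith [norm_sub_le (x - p j - v) (x - p i - w)]
    have hfar : ∀ x, (∀ v ∈ intLattice, r ≤ ‖x - p j - v‖) → Θ (Ψ x) = Ψ x := by
      intro x hx
      refine hΘs _ fun v hv => ?_
      by_contra! hlt
      have h1 := hinj (hfix _ ⟨v, hv, hlt⟩)
      rw [h1] at hlt
      exact absurd (hx v hv) (not_le.2 hlt)
    refine ⟨Θ ∘ Ψ, ⟨⟨_, Homeo0Area.trans hψ hφ, hΘl.comp hΨl⟩, fun x => ?_⟩, fun i hi => ?_,
      fun x hx => ?_⟩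
    · by_cases h : ∃ v ∈ intLattice, ‖x - p j - v‖ < r
      · rw [Function.comp_apply, hfix x h]
        exact (hΘd x).trans (by gcongr; exact hu j)
      · push Not at h
        rw [Function.comp_apply, hfar x h]
        exact hΨ.2 x
    · rcases eq_or_ne i j with rfl | hij
      · rw [Function.comp_apply, hfix _ ⟨0, zero_mem _, by simpa using hr0⟩, hΘp]
      · rw [Function.comp_apply, hfar _ fun v hv => by linarith [hsep i j hij v hv]]
        exact hmove i ((Finset.mem_insert.1 hi).resolve_left hij)
    · rw [Function.comp_apply, hfar x (hx j (Finset.mem_insert_self _ _))]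
      exact hsupp x fun i hi => hx i (Finset.mem_insert_of_mem hi)

/-- Straight motions of finitely many points without collisions in the torus are realised by
area-preserving maps. -/
theorem exists_areaMove_of_no_collision {ι : Type*} [Finite ι] (a b : ι → Plane) {d D : ℝ}
    (hd0 : 0 ≤ d) (hdD : d < D) (hab : ∀ i, ‖b i - a i‖ ≤ d)
    (hcoll : ∀ i j, i ≠ j → ∀ t ∈ Set.Icc (0 : ℝ) 1,
      (a i + t • (b i - a i)) - (a j + t • (b j - a j)) ∉ intLattice) :
    ∃ Ψ, IsAreaMove D Ψ ∧ ∀ i, Ψ (a i) = b i := by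
  cases nonempty_fintype ι
  have hD : 0 < D := hd0.trans_lt hdD
  obtain ⟨r₀, hr₀, hsep⟩ : ∃ r > 0, ∀ i j, i ≠ j → ∀ t ∈ Set.Icc (0 : ℝ) 1, ∀ v ∈ intLattice,
      r ≤ ‖(a i + t • (b i - a i)) - (a j + t • (b j - a j)) - v‖ := by
    have hpair : ∀ q : {q : ι × ι // q.1 ≠ q.2}, ∃ r > 0, ∀ t ∈ Set.Icc (0 : ℝ) 1,
        ∀ v ∈ intLattice,
        r ≤ ‖(a q.1.1 + t • (b q.1.1 - a q.1.1)) - (a q.1.2 + t • (b q.1.2 - a q.1.2)) - v‖ := by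
      rintro ⟨⟨i, j⟩, hij⟩
      let q : ℝ → Plane := fun t => (a i + t • (b i - a i)) - (a j + t • (b j - a j))
      have hq : Continuous q := by fun_prop
      obtain ⟨s, hs, hmin⟩ := isCompact_Icc.exists_isMinOn (s := Set.Icc (0 : ℝ) 1) ⟨0, by simp⟩
        (continuous_norm_sub_roundVec.comp hq).continuousOn
      refine ⟨‖q s - roundVec (q s)‖, norm_pos_iff.2 fun h => hcoll i j hij s hs ?_,
        fun t ht v hv => (hmin ht).trans (norm_sub_roundVec_le _ hv)⟩
      change q s ∈ intLattice
      rw [sub_eq_zero.1 h]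
      exact roundVec_mem _
    choose r hr0 hr using hpair
    obtain ⟨r', hr', hle⟩ := exists_pos_forall_le r hr0
    exact ⟨r', hr', fun i j hij t ht v hv => (hle ⟨(i, j), hij⟩).trans (hr _ t ht v hv)⟩
  set r := min (r₀ / 2) (1 / 2) with hr
  have hr0 : 0 < r := lt_min (by linarith) (by norm_num)
  have h2r : 2 * r ≤ r₀ := by linarith [min_le_left (r₀ / 2) (1 / 2)]
  set α := min (1 / 2) (1 - d / D) with hα
  have hdD' : d / D < 1 := (div_lt_one hD).2 hdD
  have hα0 : 0 < α := lt_min (by norm_num) (by linarith)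
  have hα1 : α < 1 := (min_le_left _ _).trans_lt (by norm_num)
  have hαD : d / (1 - α) ≤ D := by
    have h1 : α ≤ 1 - d / D := min_le_right _ _
    have h2 : d = d / D * D := by field_simp
    rw [div_le_iff₀ (by linarith)]
    nlinarith
  have hω : 0 < ‖Complex.exp (α * Complex.I) - 1‖ := by
    rw [norm_pos_iff, sub_ne_zero, Ne, Complex.exp_eq_one_iff]
    rintro ⟨n, hn⟩
    have h1 := congrArg Complex.im hn
    simp at h1
    have hpi := Real.pi_gt_three
    rcases le_or_gt n 0 with h | h
    · have : (n : ℝ) ≤ 0 := by exact_mod_cast h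
      nlinarith
    · have : (1 : ℝ) ≤ n := by exact_mod_cast h
      nlinarith
  obtain ⟨N, hN⟩ := exists_nat_gt (4 * d / (r * ‖Complex.exp (α * Complex.I) - 1‖))
  have hN0 : (0 : ℝ) < N := lt_of_le_of_lt (by positivity) hN
  have hstepsize : 4 * (d / N) ≤ r * ‖Complex.exp (α * Complex.I) - 1‖ := by
    rw [div_lt_iff₀ (by positivity)] at hN
    rw [mul_div_assoc', div_le_iff₀ hN0]
    linarith
  have hind : ∀ k ≤ N, ∃ Ψ, IsAreaMove (k * (d / N / (1 - α))) Ψ ∧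
      ∀ i, Ψ (a i) = a i + ((k : ℝ) / N) • (b i - a i) := by
    intro k
    induction k with
    | zero => exact fun _ => ⟨id, isAreaMove_id (by simp), by simp⟩
    | succ k ih =>
      intro hk
      obtain ⟨Ψ, hΨ, hpos⟩ := ih (by omega)
      have hkt : (k : ℝ) / N ∈ Set.Icc (0 : ℝ) 1 := by
        refine ⟨by positivity, (div_le_one hN0).2 ?_⟩
        exact_mod_cast (Nat.le_succ k).trans hk
      obtain ⟨Θ, hΘ, hmove, -⟩ := exists_simultaneous_move Finset.univ
        (fun i => a i + ((k : ℝ) / N) • (b i - a i)) (fun i => (1 / N : ℝ) • (b i - a i))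
        hα0 hα1 hr0 (min_le_right _ _) (by positivity : 0 ≤ d / N)
        (fun i j hij v hv => h2r.trans (hsep i j hij _ hkt v hv))
        (fun i => by
          rw [norm_smul, Real.norm_of_nonneg (by positivity), one_div, inv_mul_eq_div]
          gcongr
          exact hab i) hstepsize
      refine ⟨Θ ∘ Ψ, ?_, fun i => ?_⟩
      · have := hΘ.comp hΨ
        rwa [show d / N / (1 - α) + k * (d / N / (1 - α)) =
          ((k + 1 : ℕ) : ℝ) * (d / N / (1 - α)) by push_cast; ring] at this
      · rw [Function.comp_apply, hpos, hmove i (Finset.mem_univ i)]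
        push_cast
        rw [add_assoc, ← add_smul, ← add_div]
  obtain ⟨Ψ, hΨ, hpos⟩ := hind N le_rfl
  refine ⟨Ψ, ⟨hΨ.1, fun x => (hΨ.2 x).trans ?_⟩, fun i => ?_⟩
  · refine le_trans (le_of_eq ?_) hαD
    field_simp
  · rw [hpos, div_self hN0.ne', one_smul, add_sub_cancel]

/-- The determinant of two vectors of the plane. -/
def planeDet (x y : Plane) : ℝ := x 0 * y 1 - x 1 * y 0

/-- Finitely many points of the torus can be moved to arbitrary distinct positions at distance less
than `ε` by an area-preserving map whose displacement is less than `ε`. -/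
theorem exists_areaMove {ι : Type*} [Finite ι] (a b : ι → Plane) {ε : ℝ} (hε : 0 < ε)
    (ha : ∀ i j, i ≠ j → a i - a j ∉ intLattice) (hb : ∀ i j, i ≠ j → b i - b j ∉ intLattice)
    (hab : ∀ i, ‖b i - a i‖ < ε) : ∃ D < ε, ∃ Ψ, IsAreaMove D Ψ ∧ ∀ i, Ψ (a i) = b i := by
  obtain ⟨N, ⟨enum⟩⟩ := Finite.exists_equiv_fin ι
  let n : ι → ℝ := fun i => ((enum i : ℕ) : ℝ)
  have hn0 : ∀ i, 0 ≤ n i := fun i => Nat.cast_nonneg _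
  have hnN : ∀ i, n i ≤ N := fun i => Nat.cast_le.2 (enum i).2.le
  have hninj : ∀ i j, i ≠ j → n i - n j ≠ 0 := by
    intro i j hij h
    refine hij (enum.injective (Fin.ext ?_))
    exact Nat.cast_injective (sub_eq_zero.1 h)
  obtain ⟨δ₀, hδ₀, hδab⟩ := exists_pos_forall_le (fun i => ε - ‖b i - a i‖)
    fun i => sub_pos.2 (hab i)
  set δ := min δ₀ ε / 4 with hδ
  have hδ0 : 0 < δ := by have := lt_min hδ₀ hε; positivity
  have hδε : 4 * δ ≤ ε := by linarith [min_le_right δ₀ ε]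
  have hδab' : ∀ i, ‖b i - a i‖ ≤ ε - 4 * δ := fun i => by
    linarith [min_le_left δ₀ ε, hδab i]
  obtain ⟨ρ, hρ0, hρ⟩ : ∃ ρ > 0, ∀ i j, i ≠ j → ∀ v ∈ intLattice, ρ ≤ ‖b i - b j - v‖ := by
    choose r hr0 hr using fun q : {q : ι × ι // q.1 ≠ q.2} =>
      exists_pos_le_norm_sub (hb q.1.1 q.1.2 q.2)
    obtain ⟨ρ, hρ0, hρ⟩ := exists_pos_forall_le r hr0
    exact ⟨ρ, hρ0, fun i j hij v hv => (hρ ⟨(i, j), hij⟩).trans (hr _ v hv)⟩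
  have : Countable intLattice := countable_intLattice.to_subtype
  -- a direction transversal to all differences
  obtain ⟨κ, hκ⟩ : ∃ κ : ℝ, κ ∉ Set.range fun q : (ι × ι) × intLattice =>
      ((q.2 : Plane) - (a q.1.1 - a q.1.2)) 1 / ((q.2 : Plane) - (a q.1.1 - a q.1.2)) 0 :=
    ((Set.countable_range _).dense_compl ℝ).nonempty
  set w : Plane := !₂[1, κ] with hw
  have hwdet : ∀ i j, i ≠ j → ∀ v ∈ intLattice, planeDet w (v - (a i - a j)) ≠ 0 := by
    intro i j hij v hv h0
    have hy : v - (a i - a j) ≠ 0 := fun h => ha i j hij (sub_eq_zero.1 h ▸ hv)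
    set y := v - (a i - a j) with hyd
    have h1 : y 1 = κ * y 0 := by
      have : y 1 - κ * y 0 = 0 := by simpa [planeDet, hw] using h0
      linarith
    by_cases hy0 : y 0 = 0
    · refine hy ?_
      ext k
      fin_cases k
      · exact hy0
      · simpa [hy0] using h1
    · exact hκ ⟨((i, j), ⟨v, hv⟩), by
        change y 1 / y 0 = κ
        rw [h1]; field_simp⟩
  -- a small size of the perturbation that avoids collisions
  have hK : 0 < N * ‖w‖ + 1 := by positivity
  have hm : 0 < min δ (ρ / 4) := lt_min hδ0 (by linarith)
  obtain ⟨s, hs, hs0, hs1⟩ := ((Set.countable_range fun q : (ι × ι) × intLattice =>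
    -planeDet (b q.1.1 - b q.1.2 - q.2) (q.2 - (a q.1.1 - a q.1.2)) /
      ((n q.1.1 - n q.1.2) * planeDet w (q.2 - (a q.1.1 - a q.1.2)))).dense_compl ℝ).exists_between
      (show (0 : ℝ) < min δ (ρ / 4) / (N * ‖w‖ + 1) by positivity)
  rw [lt_div_iff₀ hK] at hs1
  let b' : ι → Plane := fun i => b i + (s * n i) • w
  have hbb' : ∀ i, ‖(s * n i) • w‖ ≤ min δ (ρ / 4) := by
    intro i
    rw [norm_smul, Real.norm_of_nonneg (mul_nonneg hs0.le (hn0 i)), mul_assoc]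
    have : n i * ‖w‖ ≤ N * ‖w‖ := by gcongr; exact hnN i
    nlinarith
  obtain ⟨Ψ₁, hΨ₁, hpos₁⟩ := exists_areaMove_of_no_collision a b' (d := ε - 3 * δ)
    (D := ε - 2 * δ) (by linarith) (by linarith)
    (fun i => by
      have : b' i - a i = (b i - a i) + (s * n i) • w := by simp only [b']; abel
      rw [this]
      linarith [norm_add_le (b i - a i) ((s * n i) • w), hδab' i, hbb' i, min_le_left δ (ρ / 4)])
    (by
      intro i j hij t ht hmem
      set v := (a i + t • (b' i - a i)) - (a j + t • (b' j - a j)) with hv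
      have hdet : t * (planeDet (b i - b j - v) (v - (a i - a j)) +
          s * ((n i - n j) * planeDet w (v - (a i - a j)))) = 0 := by
        have h1 : v - (a i - a j) = t • ((b i - b j - v) + (s * (n i - n j)) • w +
            (v - (a i - a j))) := by
          conv_lhs => rw [hv]
          simp only [b']
          module
        have h2 : (1 - t) • (v - (a i - a j)) =
            t • ((b i - b j - v) + (s * (n i - n j)) • w) := by
          rw [sub_smul, one_smul]
          nth_rw 1 [h1]
          module
        generalize v - (a i - a j) = y at h2 ⊢
        generalize b i - b j - v = z at h2 ⊢
        have e0 := congrArg (fun x : Plane => x 0) h2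
        have e1 := congrArg (fun x : Plane => x 1) h2
        simp only [PiLp.smul_apply, PiLp.add_apply, smul_eq_mul] at e0 e1
        simp only [planeDet]
        linear_combination -y 1 * e0 + y 0 * e1
      rcases mul_eq_zero.1 hdet with h | h
      · refine ha i j hij ?_
        rw [hv, h] at hmem
        simpa using hmem
      · refine hs ⟨((i, j), ⟨v, hmem⟩), ?_⟩
        have h1 := hwdet i j hij v hmem
        have h2 := hninj i j hij
        simp only
        rw [div_eq_iff (mul_ne_zero h2 h1)]
        linarith)
  obtain ⟨Ψ₂, hΨ₂, hpos₂⟩ := exists_areaMove_of_no_collision b' b (d := δ) (D := δ * (3 / 2))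
    hδ0.le (by linarith)
    (fun i => by
      have : b i - b' i = -((s * n i) • w) := by simp only [b']; abel
      rw [this, norm_neg]
      exact (hbb' i).trans (min_le_left _ _))
    (by
      intro i j hij t ht hmem
      have h1 := hρ i j hij _ hmem
      have h2 : b i - b j - ((b' i + t • (b i - b' i)) - (b' j + t • (b j - b' j))) =
          (1 - t) • ((s * n j) • w - (s * n i) • w) := by
        simp only [b']; module
      rw [h2, norm_smul, Real.norm_of_nonneg (by linarith [ht.2])] at h1
      have h3 := norm_sub_le ((s * n j) • w) ((s * n i) • w)
      have h4 := hbb' i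
      have h5 := hbb' j
      have h6 := min_le_right δ (ρ / 4)
      nlinarith [norm_nonneg ((s * n j) • w - (s * n i) • w), ht.1])
  refine ⟨δ * (3 / 2) + (ε - 2 * δ), by linarith, Ψ₂ ∘ Ψ₁, hΨ₂.comp hΨ₁, fun i => ?_⟩
  rw [Function.comp_apply, hpos₁, hpos₂]

/-! ### Periodic pseudo-orbits -/

/-- A pseudo-orbit of length `m + 1` that closes up to the integer translation `v`. -/
structure IsPseudoLoop (F : Plane → Plane) (ε : ℝ) (m : ℕ) (x : ℕ → Plane) (v : Plane) : Prop where
  mem : v ∈ intLattice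
  close : x (m + 1) = x 0 + v
  jump : ∀ i ≤ m, ‖F (x i) - x (i + 1)‖ < ε

theorem exists_isPseudoLoop {ε a b : ℝ} (hb : 0 < b) (hab : a + b ≤ ε) {x : ℕ → Plane}
    {i j : ℕ} (hij : i < j) (hx : ∀ k < j, ‖F (x k) - x (k + 1)‖ ≤ a) {v : Plane}
    (hv : v ∈ intLattice) (hclose : ‖x j - x i - v‖ < b) :
    ∃ y, IsPseudoLoop F ε (j - i - 1) y v := by
  refine ⟨fun k => if k = j - i then x i + v else x (i + k), hv, ?_, fun k hk => ?_⟩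
  · rw [if_pos (by omega), if_neg (by omega), add_zero]
  · rw [if_neg (by omega)]
    have h1 := hx (i + k) (by omega)
    split_ifs with h
    · have h2 : F (x (i + k)) - (x i + v) = (F (x (i + k)) - x j) + (x j - x i - v) := by abel
      rw [show i + k + 1 = j by omega] at h1
      rw [h2]
      linarith [norm_add_le (F (x (i + k)) - x j) (x j - x i - v)]
    · rw [← add_assoc]
      linarith

/-- Finitely many pseudo-loops are realised simultaneously as periodic orbits by an area-preserving
perturbation. -/
theorem exists_areaMove_periodic (hF : IsEquivariant F) {ε : ℝ} (hε : 0 < ε) {J : Type*} [Finite J]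
    {m : J → ℕ} {x : J → ℕ → Plane} {v : J → Plane}
    (hloop : ∀ l, IsPseudoLoop F ε (m l) (x l) (v l)) :
    ∃ D < ε, ∃ Ψ, IsAreaMove D Ψ ∧ ∀ l, ∃ y, (Ψ ∘ F)^[m l + 1] y = y + v l := by
  let ι := Σ l, Fin (m l + 1)
  obtain ⟨N, ⟨enum⟩⟩ := Finite.exists_equiv_fin ι
  let n : ι → ℝ := fun i => ((enum i : ℕ) : ℝ)
  have hninj : ∀ i j, i ≠ j → n i - n j ≠ 0 := by
    intro i j hij h
    refine hij (enum.injective (Fin.ext ?_))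
    exact Nat.cast_injective (sub_eq_zero.1 h)
  have : Countable intLattice := countable_intLattice.to_subtype
  let w : Plane := EuclideanSpace.single 0 1
  let X : ℝ → ι → Plane := fun s i => x i.1 i.2 + (s * n i) • w
  let next : ι → ι := fun i => ⟨i.1, i.2 + 1⟩
  have hnext : Function.Injective next := by
    rintro ⟨l, i⟩ ⟨l', i'⟩ h
    have h' : (⟨l, i + 1⟩ : ι) = ⟨l', i' + 1⟩ := h
    obtain rfl : l = l' := congrArg Sigma.fst h'
    rw [add_right_cancel (eq_of_heq (Sigma.mk.inj_iff.1 h').2)]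
  let z : ι → Plane := fun i => if i.2 = Fin.last _ then v i.1 else 0
  have hz : ∀ i, z i ∈ intLattice := by
    intro i
    simp only [z]
    split_ifs
    · exact (hloop i.1).mem
    · exact zero_mem _
  let U : Set ℝ := {s | ∀ i, ‖X s (next i) + z i - F (X s i)‖ < ε}
  have hU : IsOpen U := by
    simp only [U, Set.ofPred_forall]
    refine isOpen_iInter_of_finite fun i => isOpen_lt ?_ continuous_const
    have := hF.continuous
    fun_prop
  have h0U : (0 : ℝ) ∈ U := by
    intro i
    have h1 : X 0 (next i) + z i = x i.1 (i.2 + 1) := by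
      simp only [X, next, z, zero_mul, zero_smul, add_zero]
      split_ifs with h
      · rw [h, Fin.last_add_one, Fin.val_zero, Fin.val_last, (hloop i.1).close]
      · rw [Fin.val_add_one, if_neg h, add_zero]
    have h2 : X 0 i = x i.1 i.2 := by simp [X]
    rw [h1, h2, norm_sub_rev]
    exact (hloop i.1).jump _ (Nat.lt_succ_iff.1 i.2.2)
  obtain ⟨s, hsU, hs⟩ := ((Set.countable_range fun q : (ι × ι) × intLattice =>
    ((q.2 : Plane) - (x q.1.1.1 q.1.1.2 - x q.1.2.1 q.1.2.2)) 0 /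
      (n q.1.1 - n q.1.2)).dense_compl ℝ).inter_open_nonempty U hU ⟨0, h0U⟩
  have hX : ∀ i j, i ≠ j → X s i - X s j ∉ intLattice := by
    intro i j hij hmem
    refine hs ⟨((i, j), ⟨_, hmem⟩), ?_⟩
    have := hninj i j hij
    rw [div_eq_iff this]
    simp [X, w]
    ring
  obtain ⟨D, hD, Ψ, hΨ, hmove⟩ := exists_areaMove (fun i => F (X s i))
    (fun i => X s (next i) + z i) hε
    (fun i j hij hmem => by
      have h1 := hF.map_add_lattice (X s j) _ hmem
      rw [add_sub_cancel] at h1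
      refine hX i j hij ?_
      rw [← hF.injective h1, add_sub_cancel_left]
      exact hmem)
    (fun i j hij hmem => by
      refine hX _ _ (hnext.ne hij) ?_
      have := sub_mem hmem (sub_mem (hz i) (hz j))
      rwa [show X s (next i) + z i - (X s (next j) + z j) - (z i - z j) =
        X s (next i) - X s (next j) by abel] at this)
    hsU
  refine ⟨D, hD, Ψ, hΨ, fun l => ⟨X s ⟨l, 0⟩, ?_⟩⟩
  have hiter : ∀ k (hk : k ≤ m l), (Ψ ∘ F)^[k] (X s ⟨l, 0⟩) = X s ⟨l, ⟨k, by omega⟩⟩ := by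
    intro k
    induction k with
    | zero => intro _; rfl
    | succ k ih =>
      intro hk
      rw [Function.iterate_succ_apply', ih (by omega), Function.comp_apply, hmove]
      have hlast : (⟨k, by omega⟩ : Fin (m l + 1)) ≠ Fin.last _ := by
        intro h
        have := congrArg Fin.val h
        simp at this; omega
      have h1 : (⟨k, by omega⟩ : Fin (m l + 1)) + 1 = ⟨k + 1, by omega⟩ := by
        ext
        rw [Fin.val_add_one, if_neg hlast]
      simp only [z, next, if_neg hlast, h1, add_zero]
  rw [Function.iterate_succ_apply', hiter _ le_rfl, Function.comp_apply, hmove]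
  have h1 : (⟨m l, by omega⟩ : Fin (m l + 1)) = Fin.last _ := rfl
  simp only [h1, z, next, if_true, Fin.last_add_one]

/-- Pseudo-loops come close to the extreme points of the rotation set. -/
theorem exists_isPseudoLoop_gt (hF : IsEquivariant F) {ε : ℝ} (hε : 0 < ε) (hε1 : ε ≤ 1)
    (L : Plane →L[ℝ] ℝ) {w : Plane} (hw : w ∈ rotationSet F) (hne : ∃ y, L y ≤ L w - 1) :
    ∃ m x v, IsPseudoLoop F ε m x v ∧ ((m + 1 : ℕ) : ℝ) * (L w - 1) < L v := by
  by_contra! hcon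
  obtain ⟨C, hC0, hC⟩ := hF.bounded
  obtain ⟨a₀, ha₀⟩ := hne
  set A : Set Plane := {y | L y ≤ L w - 1} with hA
  have hAc : Convex ℝ A := convex_halfSpace_le L.isLinear _
  set K := 4 / (Real.pi * ε ^ 2) * (ε + (C + ‖a₀‖)) with hK
  have hdev : ∀ n z, L (F^[n] z - z) ≤ n * (L w - 1) + ‖L‖ * K := by
    intro n z
    obtain ⟨x, hx, hxs⟩ : ∃ x : ℕ → Plane, (∀ i, F^[i] z = x i) ∧ ∀ i, x (i + 1) = F (x i) :=
      ⟨fun i => F^[i] z, fun _ => rfl, fun i => Function.iterate_succ_apply' F i z⟩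
    have hjump : ∀ k, ‖F (x k) - x (k + 1)‖ ≤ 0 := fun k => by rw [hxs, sub_self, norm_zero]
    have hloop : ∀ i j, i < j → j ≤ n → ∀ v ∈ intLattice, ‖x j - x i - v‖ < ε →
        v ∈ ((j - i : ℕ) : ℝ) • A := by
      intro i j hij _ v hv hclose
      obtain ⟨y, hy⟩ := exists_isPseudoLoop (F := F) (a := 0) (x := x) hε (zero_add ε).le hij
        (fun k _ => hjump k) hv hclose
      have h1 := hcon _ _ _ hy
      rw [show j - i - 1 + 1 = j - i by omega] at h1
      have hpos : (0 : ℝ) < (j - i : ℕ) := by exact_mod_cast Nat.sub_pos_of_lt hij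
      refine ⟨((j - i : ℕ) : ℝ)⁻¹ • v, ?_, ?_⟩
      · change L _ ≤ _
        rw [map_smul, smul_eq_mul, inv_mul_le_iff₀ hpos]
        exact h1
      · simp only [smul_smul, mul_inv_cancel₀ hpos.ne', one_smul]
    have hstep : ∀ i < n, ∃ a ∈ A, ‖x (i + 1) - x i - a‖ ≤ C + ‖a₀‖ := fun i _ =>
      ⟨a₀, ha₀, by
        rw [hxs]
        exact (norm_sub_le _ _).trans (by gcongr; exact hC _)⟩
    obtain ⟨p, ⟨y, hy, rfl⟩, hp⟩ := exists_mem_smul_norm_sub_le hAc ⟨a₀, ha₀⟩ x n hε hε1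
      (by positivity : 0 ≤ C + ‖a₀‖) hloop hstep
    have hp' : ‖F^[n] z - z - (n : ℝ) • y‖ ≤ K := by
      rw [hx, show z = x 0 from hx 0]
      exact hp
    have h1 : F^[n] z - z = (n : ℝ) • y + (F^[n] z - z - (n : ℝ) • y) := by abel
    have h2 : L (F^[n] z - z - (n : ℝ) • y) ≤ ‖L‖ * K :=
      (le_abs_self _).trans ((L.le_opNorm _).trans (by gcongr))
    have h3 : (n : ℝ) * L y ≤ n * (L w - 1) := by gcongr; exact hy
    rw [h1, map_add, map_smul, smul_eq_mul]
    linarith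
  obtain ⟨n, z, hn, hz⟩ := hw
  have hl := (L.continuous.tendsto w).comp hz
  have hr : Tendsto (fun k => (L w - 1) + ‖L‖ * K * (n k : ℝ)⁻¹) atTop
      (𝓝 ((L w - 1) + ‖L‖ * K * 0)) :=
    ((tendsto_inv_atTop_zero.comp (tendsto_natCast_atTop_atTop.comp hn)).const_mul _).const_add _
  rw [mul_zero, add_zero] at hr
  have : L w ≤ L w - 1 := by
    refine le_of_tendsto_of_tendsto hl hr ?_
    filter_upwards [hn.eventually_gt_atTop 0] with k hk
    have hk' : (0 : ℝ) < n k := by exact_mod_cast hk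
    simp only [Function.comp_apply, map_smul, smul_eq_mul]
    rw [inv_mul_le_iff₀ hk']
    have := hdev (n k) (z k)
    field_simp
    linarith
  linarith

theorem IsEquivariant.isCompact_rotationSet (hF : IsEquivariant F) :
    IsCompact (rotationSet F) := by
  obtain ⟨C, hC0, hC⟩ := hF.bounded
  refine Metric.isCompact_of_isClosed_isBounded isClosed_rotationSet
    ((Metric.isBounded_closedBall (x := (0 : Plane)) (r := C)).subset fun w hw => ?_)
  simpa using IsEquivariant.norm_le_of_mem_rotationSet hC0 hC hw

theorem isotopicToId_of_mem {H : Set (Torus ≃ₜ Torus)} (hH : H = Homeo0 ∨ H = Homeo0Area)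
    {f : Torus ≃ₜ Torus} (hf : f ∈ H) : IsotopicToId f := by
  rcases hH with rfl | rfl
  exacts [hf, hf.1]

theorem trans_mem {H : Set (Torus ≃ₜ Torus)} (hH : H = Homeo0 ∨ H = Homeo0Area)
    {f φ : Torus ≃ₜ Torus} (hf : f ∈ H) (hφ : φ ∈ Homeo0Area) : f.trans φ ∈ H := by
  rcases hH with rfl | rfl
  · exact IsotopicToId.trans hf hφ.1
  · exact Homeo0Area.trans hf hφ

/-- If the rotation set is `ε`-upper-stable, then it contains the rotation vectors of all periodic
`ε`-pseudo-orbits. -/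
theorem inv_smul_mem_rotationSet_of_isUpperStable {H : Set (Torus ≃ₜ Torus)}
    (hH : H = Homeo0 ∨ H = Homeo0Area) {f : Torus ≃ₜ Torus} (hf : f ∈ H) {ε : ℝ} (hε : ε < 1)
    (hstable : IsUpperStable H ε f) (hF : IsLift F f) {m : ℕ} {x : ℕ → Plane} {v : Plane}
    (hloop : IsPseudoLoop F ε m x v) : ((m + 1 : ℕ) : ℝ)⁻¹ • v ∈ rotationSet F := by
  have hfi := isotopicToId_of_mem hH hf
  have hFe := hF.isEquivariant hfi
  obtain ⟨hε0, hst⟩ := hstable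
  let L : Fin 2 × Bool → Plane →L[ℝ] ℝ := fun j =>
    (if j.2 then (1 : ℝ) else -1) • EuclideanSpace.proj j.1
  have hL : ∀ j y, L j y = (if j.2 then (1 : ℝ) else -1) * y j.1 := fun j y => rfl
  choose w hw hmax using fun j => hFe.isCompact_rotationSet.exists_isMaxOn
    hFe.rotationSet_nonempty (L j).continuous.continuousOn
  have hext : ∀ j, ∃ m x v, IsPseudoLoop F ε m x v ∧ ((m + 1 : ℕ) : ℝ) * (L j (w j) - 1) < L j v :=
    fun j => exists_isPseudoLoop_gt hFe hε0 hε.le (L j) (hw j)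
      ⟨EuclideanSpace.single j.1 ((if j.2 then (1 : ℝ) else -1) * (L j (w j) - 1)), by
        rw [hL]
        split_ifs <;> simp⟩
  choose m' x' v' hloop' hgt using hext
  obtain ⟨D, hD, Ψ, ⟨⟨φ, hφ, hΨ⟩, hdisp⟩, hper⟩ := exists_areaMove_periodic hFe hε0
    (J := Option (Fin 2 × Bool)) (m := fun o => o.elim m m') (x := fun o => o.elim x x')
    (v := fun o => o.elim v v') (fun o => by cases o; exacts [hloop, hloop' _])
  have hgH := trans_mem hH hf hφ
  have hG : IsLift (Ψ ∘ F) (f.trans φ) := hΨ.comp hF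
  have hGe := hG.isEquivariant (isotopicToId_of_mem hH hgH)
  have hdist : distC0 f (f.trans φ) < ε := by
    refine lt_of_le_of_lt (ciSup_le fun y => ?_) hD
    obtain ⟨x, rfl⟩ := proj_surjective y
    rw [← hF.2, ← hG.2]
    refine (torusDist_proj_le _ _).trans ?_
    rw [norm_sub_rev]
    exact hdisp _
  obtain ⟨G', hG', hsub⟩ := hst _ hgH hdist F hF
  obtain ⟨k, hk, hGk⟩ := hG.exists_eq_add hG'
  have hG'eq : G' = fun x => (Ψ ∘ F) x + k := funext hGk
  have hmem : ∀ o : Option (Fin 2 × Bool),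
      ((o.elim m m' + 1 : ℕ) : ℝ)⁻¹ • o.elim v v' + k ∈ rotationSet F := by
    intro o
    obtain ⟨y, hy⟩ := hper o
    have hv : o.elim v v' ∈ intLattice := by cases o; exacts [hloop.mem, (hloop' _).mem]
    refine hsub ?_
    rw [hG'eq]
    exact hGe.add_mem_rotationSet_add_const hk
      (hGe.inv_smul_mem_rotationSet (Nat.succ_pos _) hv hy)
  have hkL : ∀ j, L j k < 1 := by
    intro j
    have h1 : L j (((m' j + 1 : ℕ) : ℝ)⁻¹ • v' j + k) ≤ L j (w j) := hmax j (hmem (some j))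
    have hpos : (0 : ℝ) < ((m' j + 1 : ℕ) : ℝ) := by positivity
    have h2 : L j (w j) - 1 < ((m' j + 1 : ℕ) : ℝ)⁻¹ * L j (v' j) := by
      rw [lt_inv_mul_iff₀ hpos]; exact hgt j
    rw [map_add, map_smul, smul_eq_mul] at h1
    linarith
  have hk0 : k = 0 := by
    ext i
    obtain ⟨n, hn⟩ := hk i
    have h1 := hkL (i, true)
    have h2 := hkL (i, false)
    rw [hL] at h1 h2
    simp [hn] at h1 h2
    have h1' : n < 1 := by exact_mod_cast h1
    have h2' : -n < 1 := by exact_mod_cast (by linarith : (-(n : ℝ)) < 1)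
    have : n = 0 := by omega
    simp [hn, this]
  simpa [hk0] using hmem none

/-- Under upper stability, pseudo-orbits stay close to multiples of the rotation set. -/
theorem exists_mem_smul_rotationSet {H : Set (Torus ≃ₜ Torus)}
    (hH : H = Homeo0 ∨ H = Homeo0Area) {f : Torus ≃ₜ Torus} (hf : f ∈ H) {ε : ℝ} (hε : ε < 1)
    (hstable : IsUpperStable H ε f) (hF : IsLift F f) {a b : ℝ} (ha : 0 ≤ a) (hb : 0 < b)
    (hab : a + b ≤ ε) (x : ℕ → Plane) (n : ℕ) (hx : ∀ i < n, ‖F (x i) - x (i + 1)‖ ≤ a) :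
    ∃ p ∈ (n : ℝ) • rotationSet F,
      ‖x n - x 0 - p‖ ≤ 4 / (Real.pi * b ^ 2) * (osc F + (a + b)) := by
  have hFe := hF.isEquivariant (isotopicToId_of_mem hH hf)
  obtain ⟨w, hw⟩ := hFe.rotationSet_nonempty
  obtain ⟨p, hp, hnorm⟩ := exists_mem_smul_norm_sub_le hFe.convex_rotationSet ⟨w, hw⟩ x n hb
    (by linarith) (add_nonneg ha hFe.osc_nonneg)
    (fun i j hij hj v hv hclose => by
      obtain ⟨y, hy⟩ := exists_isPseudoLoop hb hab hij (fun k hk => hx k (by omega)) hv hclose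
      have h1 := inv_smul_mem_rotationSet_of_isUpperStable hH hf hε hstable hF hy
      rw [show j - i - 1 + 1 = j - i by omega] at h1
      have hpos : ((j - i : ℕ) : ℝ) ≠ 0 := by exact_mod_cast (Nat.sub_pos_of_lt hij).ne'
      exact ⟨_, h1, by simp only [smul_smul, mul_inv_cancel₀ hpos, one_smul]⟩)
    (fun i hi => ⟨w, hw, by
      have h1 : x (i + 1) - x i - w = -(F (x i) - x (i + 1)) + (F (x i) - x i - w) := by abel
      rw [h1]
      refine (norm_add_le _ _).trans ?_
      rw [norm_neg]
      exact add_le_add (hx i hi) (hFe.norm_displacement_sub_le_osc _ hw)⟩)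
  refine ⟨p, hp, hnorm.trans (le_of_eq ?_)⟩
  ring

end TorusRotation

theorem mainTheorem4
    (H : Set (TorusRotation.Torus ≃ₜ TorusRotation.Torus))
    (hH : H = TorusRotation.Homeo0 ∨ H = TorusRotation.Homeo0Area)
    (f : TorusRotation.Torus ≃ₜ TorusRotation.Torus) (hf : f ∈ H)
    (ε : ℝ) (hε : ε < 1) (hstable : TorusRotation.IsUpperStable H ε f)
    (F : TorusRotation.Plane → TorusRotation.Plane) (hF : TorusRotation.IsLift F f) :
    TorusRotation.pseudoRotationSet (ε / 2) F = TorusRotation.rotationSet F ∧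
    (∀ x : ℕ → TorusRotation.Plane, TorusRotation.IsPseudoOrbit (ε / 2) F x → ∀ n : ℕ,
      Metric.infEDist (x n - x 0) ((n : ℝ) • TorusRotation.rotationSet F) ≤
        ENNReal.ofReal (16 / (Real.pi * ε ^ 2) * (TorusRotation.osc F + 2) + ε)) ∧
    (∀ x : ℕ → TorusRotation.Plane, TorusRotation.IsOrbit F x → ∀ n : ℕ,
      Metric.infEDist (x n - x 0) ((n : ℝ) • TorusRotation.rotationSet F) ≤
        ENNReal.ofReal (4 * (TorusRotation.osc F + 1) / (Real.pi * ε ^ 2) + ε)) := by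
  have hε0 : 0 < ε := hstable.1
  have hpi := Real.pi_pos
  have hosc : 0 ≤ TorusRotation.osc F :=
    (hF.isEquivariant (TorusRotation.isotopicToId_of_mem hH hf)).osc_nonneg
  have hhalf : ∀ (x : ℕ → TorusRotation.Plane) (n : ℕ),
      (∀ i < n, dist (F (x i)) (x (i + 1)) < ε / 2) →
      ∃ p ∈ (n : ℝ) • TorusRotation.rotationSet F,
        ‖x n - x 0 - p‖ ≤ 16 / (Real.pi * ε ^ 2) * (TorusRotation.osc F + 2) + ε := by
    intro x n hx
    obtain ⟨p, hp, hnorm⟩ := TorusRotation.exists_mem_smul_rotationSet hH hf hε hstable hF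
      (half_pos hε0).le (half_pos hε0) (add_halves ε).le x n
      (fun i hi => by rw [← dist_eq_norm]; exact (hx i hi).le)
    refine ⟨p, hp, hnorm.trans ?_⟩
    rw [show 4 / (Real.pi * (ε / 2) ^ 2) = 16 / (Real.pi * ε ^ 2) by field_simp; norm_num]
    have : 16 / (Real.pi * ε ^ 2) * (TorusRotation.osc F + (ε / 2 + ε / 2)) ≤
        16 / (Real.pi * ε ^ 2) * (TorusRotation.osc F + 2) := by
      gcongr; linarith
    linarith
  have hedist : ∀ (y p : TorusRotation.Plane) (S : Set TorusRotation.Plane) (c : ℝ), p ∈ S →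
      ‖y - p‖ ≤ c → Metric.infEDist y S ≤ ENNReal.ofReal c := by
    intro y p S c hp hc
    refine (Metric.infEDist_le_edist_of_mem hp).trans ?_
    rw [edist_dist, dist_eq_norm]
    exact ENNReal.ofReal_le_ofReal hc
  refine ⟨Set.Subset.antisymm ?_ ?_, fun x hx n => ?_, fun x hx n => ?_⟩
  · rintro w ⟨n, x, hn, hx, hlim⟩
    choose p hp hnorm using fun k => hhalf (x k) (n k) (hx k)
    set c := 16 / (Real.pi * ε ^ 2) * (TorusRotation.osc F + 2) + ε with hc
    choose q hq hqp using hp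
    refine TorusRotation.isClosed_rotationSet.mem_of_tendsto (b := Filter.atTop) (f := q) ?_
      (Filter.Eventually.of_forall hq)
    have hr : Filter.Tendsto (fun k => c * (n k : ℝ)⁻¹) Filter.atTop (nhds (c * 0)) :=
      (tendsto_inv_atTop_zero.comp (tendsto_natCast_atTop_atTop.comp hn)).const_mul c
    rw [mul_zero] at hr
    have hd : Filter.Tendsto (fun k => (n k : ℝ)⁻¹ • (x k (n k) - x k 0) - q k) Filter.atTop
        (nhds 0) := by
      refine squeeze_zero_norm' ?_ hr
      filter_upwards [hn.eventually_gt_atTop 0] with k hk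
      have hk' : (0 : ℝ) < n k := by exact_mod_cast hk
      have h1 : (n k : ℝ)⁻¹ • (x k (n k) - x k 0) - q k =
          (n k : ℝ)⁻¹ • (x k (n k) - x k 0 - p k) := by
        rw [← hqp k, smul_sub _ _ ((n k : ℝ) • q k), smul_smul, inv_mul_cancel₀ hk'.ne', one_smul]
      rw [h1, norm_smul, norm_inv, Real.norm_natCast, mul_comm]
      gcongr
      exact hnorm k
    simpa using hlim.sub hd
  · rintro w ⟨n, z, hn, hlim⟩
    refine ⟨n, fun k i => F^[i] (z k), hn, fun k i _ => ?_, hlim⟩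
    change dist (F (F^[i] (z k))) (F^[i + 1] (z k)) < ε / 2
    rw [Function.iterate_succ_apply', dist_self]
    exact half_pos hε0
  · obtain ⟨p, hp, hnorm⟩ := hhalf x n fun i _ => hx i
    exact hedist _ p _ _ hp hnorm
  · obtain ⟨p, hp, hnorm⟩ := TorusRotation.exists_mem_smul_rotationSet hH hf hε hstable hF
      le_rfl hε0 (zero_add ε).le x n (fun i _ => by rw [hx i, sub_self, norm_zero])
    refine hedist _ p _ _ hp (hnorm.trans ?_)
    rw [mul_div_right_comm]
    have : 4 / (Real.pi * ε ^ 2) * (TorusRotation.osc F + (0 + ε)) ≤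
        4 / (Real.pi * ε ^ 2) * (TorusRotation.osc F + 1) := by
      gcongr; linarith
    linarith
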